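/- Let $n\ge 1$, $A\in\mathbb R^{n\times n}$, $B\in\mathbb R^{n\times m}$ with $(A,B)$ controllable, and let $g_1,\dots,g_m:[0,\infty)\to\mathbb R$ be $C^{n-1}$, bounded with bounded derivatives up to order $n-1$, and persistently exciting, i.e. for each $q$ there are $a_1,a_2,\delta>0$ with $a_1\le\int_t^{t+\delta}g_q(\tau)^2\,d\tau\le a_2$ for all $t\ge 0$. Consider $\dot x=Ax+BG(t)u$ with $G=\mathrm{diag}(g_1,\dots,g_m)$. **Canonical form.** After a suitable renumbering of the inputs there are an integer $p\ge1$, block sizes $r_1,\dots,r_p\ge 1$ and an invertible linear map $z=Tx$, where $z$ consists of blocks ${}^jz=({}^jz_1,\dots,{}^jz_{r_j})$, $j=1,\dots,p$, such that $\hat A=TAT^{-1}$ has blocks $\hat A_{k,j}$ (row block $k$, column block $j$) as follows: $\hat A_{j,j}$ is the companion matrix with ones on the superdiagonal and last row $(-\alpha_{j,r_j},\dots,-\alpha_{j,1})$; for $k<j$, $\hat A_{k,j}$ has first column $(\beta_{k,j,1},\dots,\beta_{k,j,r_k})^T$ and all other columns zero; $\hat A_{k,j}=0$ for $k>j$; and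 for $j\le p$ the $j$-th column of $TB$ is the unit vector of the coordinate ${}^jz_{r_j}$, the other columns of $TB$ being arbitrary. **Feedback.** Fix any such form. Let $r=\max_j r_j$, $k=\max\{2,2^{\lceil\log_2 r\rceil}\}$, $\lambda_1,\dots,\lambda_p>0$, and let the persistence filters satisfy $\dot R_j=-\lambda_jR_j+g_j^k$ on $[0,\infty)$, $R_j(0)>0$. Along a trajectory define the augmented states by ${}^j\Omega_1={}^jz_1$ and $${}^j\Omega_{i+1}=\tfrac{d}{dt}\,{}^j\Omega_i+\frac{g_j^k}{2R_j}\,{}^j\Omega_i-\sum_{s=j+1}^p\beta_{j,s,i}\,{}^s\Omega_1,\qquad 1\le i\le r_j-1,$$ and apply the feedback law $u_j=0$ for $j>p$ and, for $j\le p$, $$u_j=-\frac1{g_j}\sum_{i=1}^{r_j}\alpha_{j,r_j-i+1}({}^j\Omega_i-{}^jz_i)-\frac1{g_j}\frac{d}{dt}({}^j\Omega_{r_j}-{}^jz_{r_j})-\frac{g_j^{k-1}}{2R_j}\,{}^j\Omega_{r_j},$$ where the division by $g_j$ is symbolic, i.e. the law is understood after multiplication by $g_j$. **Conditions.** With $\|\cdot\|$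 the spectral norm for matrices and the Euclidean norm for vectors, put $\gamma_j=\lambda_j-\lambda_j^*$, where $\lambda_j^*$ is the maximum of $1+|\alpha_{j,r_j}|$, of $2+|\alpha_{j,r_j-l+1}|$ for $2\le l\le r_j-1$, and of $1-2\alpha_{j,1}+\sum_{i=1}^{r_j-1}|\alpha_{j,r_j-i+1}|$. Assume $$\gamma_1>\sum_{s>1}\|\hat A_{1,s}\|,\qquad \gamma_j>\sum_{s>j}\|\hat A_{j,s}\|+2\sum_{s<j}\|\hat A_{s,j}\|\ (2\le j\le p-1),\qquad \gamma_p>\sum_{s<p}\|\hat A_{s,p}\|,$$ and let $$\sigma=\min\Big\{\frac{\gamma_p}2,\ \min_{2\le j\le p-1}\frac{\gamma_j-\sum_{s>j}\|\hat A_{j,s}\|}2,\ \gamma_1-\sum_{s>1}\|\hat A_{1,s}\|\Big\}.$$ **Conclusion.** Filters exist from all positive initial values, $\sigma>0$, and for given filters $R_1,\dots,R_p$ there is $M>0$ such that for every $t_0\ge0$: from every initial state $x(t_0)$ there is a closed-loop trajectory on $[t_0,\infty)$ with a continuous control $u$, and every closed-loop trajectory on $[t_0,\infty)$ satisfies $$\|x(t)\|\le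 M e^{-\frac{\sigma}{2}(t-t_0)}\|x(t_0)\|,\qquad t\ge t_0 .$$ Moreover the rate can be made arbitrarily large: for every $\rho\in\mathbb R$ there are $\lambda_1,\dots,\lambda_p>0$ satisfying the above inequalities with $\sigma/2\ge\rho$. -/

import Mathlib

open Set Matrix

open scoped Matrix.Norms.L2Operator

noncomputable section

namespace PersistentFilter

/-- `(A, B)` is a controllable pair: the matrix `[B, AB, …, A^(n-1) B]` has rank `n`. -/
def Controllable {n m : ℕ} (A : Matrix (Fin n) (Fin n) ℝ) (B : Matrix (Fin n) (Fin m) ℝ) : Prop :=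
  (Matrix.of fun (i : Fin n) (kj : Fin n × Fin m) => (A ^ (kj.1 : ℕ) * B) i kj.2).rank = n

/-- `g : [0,∞) → ℝ` is of class `C^d` and bounded, with bounded derivatives up to order `d`. -/
def BoundedDerivs (d : ℕ) (g : ℝ → ℝ) : Prop :=
  ContDiffOn ℝ d g (Ici 0) ∧
    ∀ i ≤ d, ∃ C : ℝ, ∀ t ∈ Ici (0 : ℝ), |iteratedDerivWithin i g (Ici 0) t| ≤ C

/-- Persistence of excitation of a scalar signal on `[0,∞)`. -/
def PersistentlyExciting (g : ℝ → ℝ) : Prop :=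
  ∃ a₁ a₂ δ : ℝ, 0 < a₁ ∧ 0 < a₂ ∧ 0 < δ ∧
    ∀ t : ℝ, 0 ≤ t → a₁ ≤ ∫ τ in t..(t + δ), g τ ^ 2 ∧ ∫ τ in t..(t + δ), g τ ^ 2 ≤ a₂

/-- The numerical data of a block canonical form with `m` inputs. The blocks are numbered
`0, …, p - 1` and everything else is numbered from `0` too, so that `α j 0` is the coefficient
usually written `α_{j,1}`, and `α j i.rev` is `α_{j, r_j - i + 1}` in numbering from `1`.
`inp j` is the input that drives block `j`. -/
structure BlockData (m : ℕ) where
  /-- number of blocks -/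
  p : ℕ
  p_pos : 0 < p
  /-- block sizes -/
  r : Fin p → ℕ
  r_pos : ∀ j, 0 < r j
  /-- the input attached to each block -/
  inp : Fin p ↪ Fin m
  /-- coefficients of the companion (diagonal) blocks -/
  α : (j : Fin p) → Fin (r j) → ℝ
  /-- coefficients `β k j l` of the coupling blocks, used for `k < j` -/
  β : (k : Fin p) → Fin p → Fin (r k) → ℝ

namespace BlockData

variable {m : ℕ} (D : BlockData m)

/-- Index set of the transformed state `z`: a block and a position in it. -/
abbrev Idx : Type := Σ j : Fin D.p, Fin (D.r j)

/-- First position of block `j`. -/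
def fst (j : Fin D.p) : Fin (D.r j) := ⟨0, D.r_pos j⟩

/-- Last position of block `j`. -/
def lst (j : Fin D.p) : Fin (D.r j) := ⟨D.r j - 1, Nat.sub_lt (D.r_pos j) Nat.one_pos⟩

/-- First block. -/
def fstBlock : Fin D.p := ⟨0, D.p_pos⟩

/-- Last block. -/
def lstBlock : Fin D.p := ⟨D.p - 1, Nat.sub_lt D.p_pos Nat.one_pos⟩

/-- The block `Â_{k,j}`: a companion matrix if `k = j`, a matrix with only its first column
possibly nonzero if `k < j`, and zero if `j < k`. -/
def block (k j : Fin D.p) : Matrix (Fin (D.r k)) (Fin (D.r j)) ℝ :=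
  Matrix.of fun l i =>
    if k = j then
      if (l : ℕ) + 1 = D.r k then - D.α j i.rev
      else if (i : ℕ) = (l : ℕ) + 1 then 1 else 0
    else if k < j then
      if (i : ℕ) = 0 then D.β k j l else 0
    else 0

/-- The block triangular matrix `Â`. -/
def Ahat : Matrix D.Idx D.Idx ℝ :=
  Matrix.of fun a b => D.block a.1 b.1 a.2 b.2

/-- `z = T x` transforms `(A, B)` to the block canonical form: `T A T⁻¹ = Â`, and the column of
`T B` that belongs to the input of block `j` is the unit vector of the last position of block `j`;
the other columns of `T B` are arbitrary. -/
def IsCanonicalForm {n : ℕ} (A : Matrix (Fin n) (Fin n) ℝ) (B : Matrix (Fin n) (Fin m) ℝ)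
    (T : Matrix D.Idx (Fin n) ℝ) : Prop :=
  (∃ S : Matrix (Fin n) D.Idx ℝ, T * S = 1 ∧ S * T = 1 ∧ T * A * S = D.Ahat) ∧
    ∀ j : Fin D.p, (fun a => (T * B) a (D.inp j)) = Pi.single ⟨j, D.lst j⟩ 1

/-- The size `r` of the largest block. -/
def rmax : ℕ := Finset.univ.sup D.r

/-- The exponent `k = max {2, 2 ^ ⌈log₂ r⌉}`. -/
def expo : ℕ := max 2 (2 ^ Nat.clog 2 D.rmax)

/-- `R j` solves the persistence filter equation with gain `lam j` on `[0,∞)`, from a positive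
initial value. -/
def IsPersistenceFilter (g : Fin m → ℝ → ℝ) (lam : Fin D.p → ℝ) (R : Fin D.p → ℝ → ℝ) : Prop :=
  ∀ j, 0 < R j 0 ∧ ∀ t ∈ Ici (0 : ℝ),
    HasDerivWithinAt (R j) (- lam j * R j t + g (D.inp j) t ^ D.expo) (Ici 0) t

/-- The threshold `λ_j^*`: the maximum of `1 + |α_{j,r_j}|`, of `2 + |α_{j,r_j-l+1}|` for
`2 ≤ l ≤ r_j - 1`, and of `1 - 2 α_{j,1} + ∑_{i=1}^{r_j-1} |α_{j,r_j-i+1}|`. -/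
def lamStar (j : Fin D.p) : ℝ :=
  (insert (1 + |D.α j (D.lst j)|)
    (insert (1 - 2 * D.α j (D.fst j)
        + ∑ i ∈ Finset.univ.filter (fun i : Fin (D.r j) => (i : ℕ) + 1 < D.r j), |D.α j i.rev|)
      ((Finset.univ.filter (fun l : Fin (D.r j) => 0 < (l : ℕ) ∧ (l : ℕ) + 1 < D.r j)).image
        fun l => 2 + |D.α j l.rev|))).max' (Finset.insert_nonempty _ _)

/-- `γ_j = λ_j - λ_j^*`. -/
def gam (lam : Fin D.p → ℝ) (j : Fin D.p) : ℝ := lam j - D.lamStar j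

/-- `∑_{s > j} ‖Â_{j,s}‖` (spectral norms). -/
def rowSum (j : Fin D.p) : ℝ := ∑ s ∈ Finset.Ioi j, ‖D.block j s‖

/-- `∑_{s < j} ‖Â_{s,j}‖` (spectral norms). -/
def colSum (j : Fin D.p) : ℝ := ∑ s ∈ Finset.Iio j, ‖D.block s j‖

/-- The blocks that are neither first nor last. -/
def midBlocks : Finset (Fin D.p) :=
  Finset.univ.filter fun j => 0 < (j : ℕ) ∧ (j : ℕ) + 1 < D.p

/-- The coupling inequalities on the filter gains. -/
def CouplingIneq (lam : Fin D.p → ℝ) : Prop :=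
  D.rowSum D.fstBlock < D.gam lam D.fstBlock ∧
  (∀ j ∈ D.midBlocks, D.rowSum j + 2 * D.colSum j < D.gam lam j) ∧
  D.colSum D.lstBlock < D.gam lam D.lstBlock

/-- The rate estimate `σ`. -/
def sigma (lam : Fin D.p → ℝ) : ℝ :=
  (insert (D.gam lam D.lstBlock / 2)
    (insert (D.gam lam D.fstBlock - D.rowSum D.fstBlock)
      (D.midBlocks.image fun j => (D.gam lam j - D.rowSum j) / 2))).min'
    (Finset.insert_nonempty _ _)

/-- `x` is a trajectory on `[t₀,∞)` of `ẋ = A x + B G(t) u` under the feedback law, with augmented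
states `Ω`. All derivatives with respect to time are along the trajectory.

The feedback law is
`u_j = -(1/g_j) ∑_i α_{j,r_j-i+1} (Ω_i - z_i) - (1/g_j) d/dt (Ω_{r_j} - z_{r_j}) - g_j^(k-1)/(2 R_j) Ω_{r_j}`
where the division by `g_j`, which may vanish, is symbolic; so it is written here multiplied out
by `g_j`. The input acts on the system only through `g_j u_j`. -/
structure ClosedLoop {n : ℕ} (A : Matrix (Fin n) (Fin n) ℝ) (B : Matrix (Fin n) (Fin m) ℝ)
    (T : Matrix D.Idx (Fin n) ℝ) (g : Fin m → ℝ → ℝ) (R : Fin D.p → ℝ → ℝ) (t₀ : ℝ)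
    (x : ℝ → Fin n → ℝ) (u : ℝ → Fin m → ℝ) (Ω : (j : Fin D.p) → Fin (D.r j) → ℝ → ℝ) :
    Prop where
  plant : ∀ t ∈ Ici t₀, HasDerivWithinAt x
    (A *ᵥ x t + (B * Matrix.diagonal fun j => g j t) *ᵥ u t) (Ici t₀) t
  aug_diff : ∀ j i, DifferentiableOn ℝ (Ω j i) (Ici t₀)
  aug_first : ∀ j, ∀ t ∈ Ici t₀, Ω j (D.fst j) t = (T *ᵥ x t) ⟨j, D.fst j⟩
  aug_next : ∀ j, ∀ i i' : Fin (D.r j), (i' : ℕ) = (i : ℕ) + 1 → ∀ t ∈ Ici t₀,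
    Ω j i' t = derivWithin (Ω j i) (Ici t₀) t
      + g (D.inp j) t ^ D.expo / (2 * R j t) * Ω j i t
      - ∑ s ∈ Finset.Ioi j, D.β j s i * Ω s (D.fst s) t
  control : ∀ j, ∀ t ∈ Ici t₀,
    g (D.inp j) t * u t (D.inp j) =
      - ∑ i, D.α j i.rev * (Ω j i t - (T *ᵥ x t) ⟨j, i⟩)
      - derivWithin (fun τ => Ω j (D.lst j) τ - (T *ᵥ x τ) ⟨j, D.lst j⟩) (Ici t₀) t
      - g (D.inp j) t ^ D.expo / (2 * R j t) * Ω j (D.lst j) t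
  control_unused : ∀ q : Fin m, (∀ j, q ≠ D.inp j) → ∀ t ∈ Ici t₀, u t q = 0

end BlockData

end PersistentFilter

end

/-! In the augmented states the closed loop is linear, `Ω' = (Â - diag h) Ω` with damping `h_j = g_j
^ k / (2 R_j)`: at the last position of a block the control cancels from the feedback law and leaves
exactly this equation. The filter is tailored to the energy `R_j |Ω_j|²`: the term `g_j ^ k |Ω_j|²`
from the derivative of `R_j` cancels the damping, and `-λ_j R_j |Ω_j|² + 2 R_j Ω_j · (Â Ω)_j`
remains. The gain beats the companion block (`companion_form_le`) and the coupling norms; as `Â` is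
block triangular, weights `N ^ j` with `N` large absorb the cross terms (`dissipation_le`).
Persistent excitation keeps `R_j` between positive constants (`filter_lower`, `filter_le`), so the
energy is comparable with `|Ω|²`, and `|Ω|` decays at rate `σ / 2` (`augmented_decay`).

The way back to `x` is `Ω - z = P(t) Ω` with `P` bounded and strictly triangular in a suitable order
of the positions, so that `1 - P` has a uniformly bounded inverse (`exists_bound_unipotent`). The
rows of `P` obey a recursion that starts from `g_j ^ k` and costs one derivative and one factor
`g_j` per step. Since `r_j ≤ n` and `r_j ≤ k`, `n - 1` derivatives suffice and a factor `g_j`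
survives to the end; dividing by it gives a continuous control (`divPow_augCoeff`,
`exists_closedLoop`).

The canonical form comes from the minimal polynomial `χ` of each column of `B` relative to the
Krylov space of the preceding columns: the Horner quotients of `χ`, applied to the column, give a
basis on which `A` acts as a shift up to the required corrections (`mulVec_canonicalVec`). -/

namespace PersistentFilter

/-! ### Functions with bounded derivatives. -/

/-- `f` is bounded on `[0,∞)` together with its first `d` derivatives, the last of which is
continuous. -/
def BD : ℕ → (ℝ → ℝ) → Prop
  | 0, f => ContinuousOn f (Ici 0) ∧ ∃ C : ℝ, ∀ t ∈ Ici (0 : ℝ), |f t| ≤ C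
  | d + 1, f => (∃ C : ℝ, ∀ t ∈ Ici (0 : ℝ), |f t| ≤ C) ∧
      ∃ f' : ℝ → ℝ, (∀ t ∈ Ici (0 : ℝ), HasDerivWithinAt f (f' t) (Ici 0) t) ∧ BD d f'

namespace BD

theorem bdd {d : ℕ} {f : ℝ → ℝ} (h : BD d f) : ∃ C : ℝ, ∀ t ∈ Ici (0 : ℝ), |f t| ≤ C := by
  cases d with
  | zero => exact h.2
  | succ d => exact h.1

theorem continuousOn {d : ℕ} {f : ℝ → ℝ} (h : BD d f) : ContinuousOn f (Ici 0) := by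
  cases d with
  | zero => exact h.1
  | succ d =>
    obtain ⟨-, f', h', -⟩ := h
    exact fun t ht => (h' t ht).continuousWithinAt

theorem zero_of {d : ℕ} {f : ℝ → ℝ} (h : BD d f) : BD 0 f := ⟨h.continuousOn, h.bdd⟩

theorem pred {d : ℕ} {f : ℝ → ℝ} (h : BD (d + 1) f) : BD d f := by
  induction d generalizing f with
  | zero => exact h.zero_of
  | succ d ih =>
    obtain ⟨hb, f', h', hf'⟩ := h
    exact ⟨hb, f', h', ih hf'⟩

theorem mono {d e : ℕ} {f : ℝ → ℝ} (h : BD d f) (hed : e ≤ d) : BD e f := by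
  induction d, hed using Nat.le_induction with
  | base => exact h
  | succ d _ ih => exact ih h.pred

theorem const (d : ℕ) (c : ℝ) : BD d fun _ => c := by
  induction d generalizing c with
  | zero => exact ⟨continuousOn_const, |c|, fun _ _ => le_rfl⟩
  | succ d ih =>
    exact ⟨⟨|c|, fun _ _ => le_rfl⟩, fun _ => 0, fun t _ => hasDerivWithinAt_const t _ c, ih 0⟩

theorem add {d : ℕ} {f₁ f₂ : ℝ → ℝ} (h₁ : BD d f₁) (h₂ : BD d f₂) :
    BD d fun t => f₁ t + f₂ t := by
  have hb : ∃ C : ℝ, ∀ t ∈ Ici (0 : ℝ), |f₁ t + f₂ t| ≤ C := by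
    obtain ⟨C₁, hC₁⟩ := h₁.bdd
    obtain ⟨C₂, hC₂⟩ := h₂.bdd
    exact ⟨C₁ + C₂, fun t ht => (abs_add_le _ _).trans (add_le_add (hC₁ t ht) (hC₂ t ht))⟩
  induction d generalizing f₁ f₂ with
  | zero => exact ⟨h₁.continuousOn.add h₂.continuousOn, hb⟩
  | succ d ih =>
    obtain ⟨-, f₁', d₁, b₁⟩ := h₁
    obtain ⟨-, f₂', d₂, b₂⟩ := h₂
    refine ⟨hb, _, fun t ht => (d₁ t ht).add (d₂ t ht), ih b₁ b₂ ?_⟩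
    obtain ⟨C₁, hC₁⟩ := b₁.bdd
    obtain ⟨C₂, hC₂⟩ := b₂.bdd
    exact ⟨C₁ + C₂, fun t ht => (abs_add_le _ _).trans (add_le_add (hC₁ t ht) (hC₂ t ht))⟩

theorem mul {d : ℕ} {f₁ f₂ : ℝ → ℝ} (h₁ : BD d f₁) (h₂ : BD d f₂) :
    BD d fun t => f₁ t * f₂ t := by
  have hb : ∀ {d : ℕ} {f₁ f₂ : ℝ → ℝ}, BD d f₁ → BD d f₂ →
      ∃ C : ℝ, ∀ t ∈ Ici (0 : ℝ), |f₁ t * f₂ t| ≤ C := by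
    intro d f₁ f₂ h₁ h₂
    obtain ⟨C₁, hC₁⟩ := h₁.bdd
    obtain ⟨C₂, hC₂⟩ := h₂.bdd
    refine ⟨C₁ * C₂, fun t ht => ?_⟩
    rw [abs_mul]
    exact mul_le_mul (hC₁ t ht) (hC₂ t ht) (abs_nonneg _) ((abs_nonneg _).trans (hC₁ t ht))
  induction d generalizing f₁ f₂ with
  | zero => exact ⟨h₁.continuousOn.mul h₂.continuousOn, hb h₁ h₂⟩
  | succ d ih =>
    have p₁ := h₁.pred
    have p₂ := h₂.pred
    have hb' := hb h₁ h₂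
    obtain ⟨-, f₁', d₁, b₁⟩ := h₁
    obtain ⟨-, f₂', d₂, b₂⟩ := h₂
    exact ⟨hb', _, fun t ht => (d₁ t ht).mul (d₂ t ht), (ih b₁ p₂).add (ih p₁ b₂)⟩

theorem const_mul {d : ℕ} {f : ℝ → ℝ} (c : ℝ) (h : BD d f) : BD d fun t => c * f t :=
  (const d c).mul h

theorem pow {d : ℕ} {f : ℝ → ℝ} (h : BD d f) (k : ℕ) : BD d fun t => f t ^ k := by
  induction k with
  | zero => simpa using const d 1
  | succ k ih => simpa [pow_succ] using ih.mul h

theorem congr {d : ℕ} {f₁ f₂ : ℝ → ℝ} (h : BD d f₁) (he : ∀ t ∈ Ici (0 : ℝ), f₂ t = f₁ t) :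
    BD d f₂ := by
  have hb : ∃ C : ℝ, ∀ t ∈ Ici (0 : ℝ), |f₂ t| ≤ C := by
    obtain ⟨C, hC⟩ := h.bdd
    exact ⟨C, fun t ht => by rw [he t ht]; exact hC t ht⟩
  cases d with
  | zero => exact ⟨h.1.congr he, hb⟩
  | succ d =>
    obtain ⟨-, f', d₁, b₁⟩ := h
    exact ⟨hb, f', fun t ht => (d₁ t ht).congr he (he t ht), b₁⟩

theorem inv {d : ℕ} {f : ℝ → ℝ} (h : BD d f) {c : ℝ} (hc : 0 < c)
    (hf : ∀ t ∈ Ici (0 : ℝ), c ≤ f t) : BD d fun t => (f t)⁻¹ := by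
  have hb : ∃ C : ℝ, ∀ t ∈ Ici (0 : ℝ), |(f t)⁻¹| ≤ C := by
    refine ⟨c⁻¹, fun t ht => ?_⟩
    rw [abs_of_pos (inv_pos.2 (hc.trans_le (hf t ht)))]
    exact inv_anti₀ hc (hf t ht)
  have h0 : ∀ t ∈ Ici (0 : ℝ), f t ≠ 0 := fun t ht => (hc.trans_le (hf t ht)).ne'
  induction d with
  | zero => exact ⟨h.continuousOn.inv₀ h0, hb⟩
  | succ d ih =>
    have hi := ih h.pred
    obtain ⟨-, f', d₁, b₁⟩ := h
    refine ⟨hb, _, fun t ht => (d₁ t ht).inv (h0 t ht), ?_⟩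
    refine ((b₁.const_mul (-1)).mul (hi.pow 2)).congr fun t _ => ?_
    rw [inv_pow, div_eq_mul_inv, neg_one_mul]

end BD

/-- The recursive predicate `BD` asks only for some derivative at each level, which turns closure
under products and reciprocals into plain inductions without iterated derivatives. -/
theorem BoundedDerivs.bd {d : ℕ} {g : ℝ → ℝ} (h : BoundedDerivs d g) : BD d g := by
  induction d generalizing g with
  | zero =>
    refine ⟨h.1.continuousOn, ?_⟩
    simpa using h.2 0 le_rfl
  | succ d ih =>
    refine ⟨by simpa using h.2 0 (Nat.zero_le _), derivWithin g (Ici 0), fun t ht => ?_, ih ⟨?_, ?_⟩⟩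
    · exact ((h.1.differentiableOn (by simp)) t ht).hasDerivWithinAt
    · exact h.1.derivWithin (uniqueDiffOn_Ici 0) (by norm_cast)
    · intro i hi
      obtain ⟨C, hC⟩ := h.2 (i + 1) (by omega)
      refine ⟨C, fun t ht => ?_⟩
      rw [← iteratedDerivWithin_succ']
      exact hC t ht

/-! ### Functions divisible by a power of the excitation. -/

/-- `c` is `g ^ e` times a function with `d` bounded derivatives on `[0,∞)`. -/
def DivPow (g : ℝ → ℝ) (e d : ℕ) (c : ℝ → ℝ) : Prop :=
  ∃ w : ℝ → ℝ, BD d w ∧ ∀ t ∈ Ici (0 : ℝ), c t = g t ^ e * w t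

namespace DivPow

variable {g : ℝ → ℝ} {e d : ℕ}

theorem zero : DivPow g e d fun _ => 0 := ⟨fun _ => 0, BD.const d 0, fun _ _ => by simp⟩

theorem add {c₁ c₂ : ℝ → ℝ} (h₁ : DivPow g e d c₁) (h₂ : DivPow g e d c₂) :
    DivPow g e d fun t => c₁ t + c₂ t := by
  obtain ⟨w₁, b₁, e₁⟩ := h₁
  obtain ⟨w₂, b₂, e₂⟩ := h₂
  exact ⟨_, b₁.add b₂, fun t ht => by simp only [e₁ t ht, e₂ t ht]; ring⟩

theorem mul {c f : ℝ → ℝ} (h : DivPow g e d c) (hf : BD d f) :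
    DivPow g e d fun t => c t * f t := by
  obtain ⟨w, b, e₁⟩ := h
  exact ⟨_, b.mul hf, fun t ht => by simp only [e₁ t ht]; ring⟩

theorem sum {ι : Type*} (s : Finset ι) {c : ι → ℝ → ℝ} (h : ∀ i ∈ s, DivPow g e d (c i)) :
    DivPow g e d fun t => ∑ i ∈ s, c i t := by
  classical
  induction s using Finset.induction_on with
  | empty => simpa using zero
  | insert a s ha ih =>
    simp only [Finset.sum_insert ha]
    exact (h a (by simp)).add (ih fun i hi => h i (by simp [hi]))

theorem congr {c₁ c₂ : ℝ → ℝ} (h : DivPow g e d c₁) (he : ∀ t ∈ Ici (0 : ℝ), c₂ t = c₁ t) :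
    DivPow g e d c₂ := by
  obtain ⟨w, b, e₁⟩ := h
  exact ⟨w, b, fun t ht => by rw [he t ht, e₁ t ht]⟩

theorem mono {e' d' : ℕ} {c : ℝ → ℝ} (hg : BD d' g) (h : DivPow g e d c) (he : e' ≤ e)
    (hd : d' ≤ d) : DivPow g e' d' c := by
  obtain ⟨w, b, e₁⟩ := h
  refine ⟨_, (hg.pow (e - e')).mul (b.mono hd), fun t ht => ?_⟩
  rw [e₁ t ht, ← mul_assoc, ← pow_add, Nat.add_sub_cancel' he]

theorem bd {c : ℝ → ℝ} (hg : BD d g) (h : DivPow g e d c) : BD d c := by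
  obtain ⟨w, b, e₁⟩ := h
  exact ((hg.pow e).mul b).congr e₁

/-- By the product rule the derivative of `g ^ (e + 1) * w` keeps the factor `g ^ e`:
differentiation costs one power and one order of smoothness. -/
theorem hasDerivWithinAt {c : ℝ → ℝ} (hg : BD (d + 1) g) (h : DivPow g (e + 1) (d + 1) c) :
    ∃ c' : ℝ → ℝ, (∀ t ∈ Ici (0 : ℝ), HasDerivWithinAt c (c' t) (Ici 0) t) ∧ DivPow g e d c' := by
  obtain ⟨w, b, e₁⟩ := h
  have bp := b.pred
  have gp := hg.pred
  obtain ⟨-, w', hw', bw'⟩ := b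
  obtain ⟨-, g', hg', bg'⟩ := hg
  refine ⟨fun t => g t ^ e * ((e + 1) * g' t * w t + g t * w' t), fun t ht => ?_,
    _, ((bg'.const_mul (e + 1)).mul bp).add (gp.mul bw'), fun t _ => rfl⟩
  refine HasDerivWithinAt.congr_deriv
    ((((hg' t ht).pow (e + 1)).mul (hw' t ht)).congr (fun s hs => ?_) ?_) ?_
  · exact e₁ s hs
  · exact e₁ t ht
  · push_cast; simp; ring

end DivPow

/-! ### Global solutions of linear differential equations. -/

open scoped BoundedContinuousFunction in
/-- A linear differential equation with bounded continuous coefficients has global solutions to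
the right of the initial time. -/
theorem exists_linear_ode_solution {E : Type*} [NormedAddCommGroup E] [NormedSpace ℝ E]
    [CompleteSpace E] (F : ℝ → E →L[ℝ] E) (hF : Continuous F) {K : ℝ} (hK : 0 ≤ K)
    (hb : ∀ t, ‖F t‖ ≤ K) (t₀ : ℝ) (x₀ : E) :
    ∃ y : ℝ → E, y t₀ = x₀ ∧ ∀ t ∈ Ici t₀, HasDerivWithinAt y (F t (y t)) (Ici t₀) t := by
  -- The unknown of the fixed point problem is `exp (-c (t - t₀)) x(t)`. In this weighted norm the
  -- Picard map has Lipschitz constant `K / c`, which is below 1 for `c = K + 1`, on the whole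
  -- half-line at once.
  set c : ℝ := K + 1 with hc
  have hcpos : 0 < c := by positivity
  have hcont : ∀ y : ℝ →ᵇ E, Continuous fun s => Real.exp (c * (s - t₀)) • F s (y s) := fun y => by
    have := y.continuous
    fun_prop
  have hint : ∀ t, t₀ ≤ t → Real.exp (-(c * (t - t₀))) *
      ∫ s in t₀..t, Real.exp (c * (s - t₀)) ≤ 1 / c := by
    intro t ht
    have : ∫ s in t₀..t, Real.exp (c * (s - t₀)) = (Real.exp (c * (t - t₀)) - 1) / c := by
      rw [intervalIntegral.integral_eq_sub_of_hasDerivAt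
        (f := fun s => Real.exp (c * (s - t₀)) / c) (fun s _ => ?_)
        (Continuous.intervalIntegrable (by fun_prop) _ _)]
      · simp; ring
      · have h := (((hasDerivAt_id s).sub_const t₀).const_mul c).exp.div_const c
        simp only [id, mul_one] at h
        rwa [mul_div_cancel_right₀ _ hcpos.ne'] at h
    rw [this, Real.exp_neg, inv_mul_eq_div, div_div, div_le_div_iff₀ (by positivity) hcpos]
    nlinarith [Real.exp_pos (c * (t - t₀))]
  let Ψ : (ℝ →ᵇ E) → ℝ → E := fun y t =>
    Real.exp (-(c * (t - t₀))) • (x₀ + ∫ s in t₀..t, Real.exp (c * (s - t₀)) • F s (y s))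
  have hest : ∀ (y z : ℝ →ᵇ E) t, t₀ ≤ t → Real.exp (-(c * (t - t₀))) *
      ‖∫ s in t₀..t, Real.exp (c * (s - t₀)) • F s (y s - z s)‖ ≤ K / c * dist y z := by
    intro y z t ht
    have hle : ‖∫ s in t₀..t, Real.exp (c * (s - t₀)) • F s (y s - z s)‖ ≤
        ∫ s in t₀..t, Real.exp (c * (s - t₀)) * (K * dist y z) := by
      refine intervalIntegral.norm_integral_le_of_norm_le ht
        (MeasureTheory.ae_of_all _ fun s _ => ?_)
        (Continuous.intervalIntegrable (by fun_prop) _ _)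
      rw [norm_smul, Real.norm_of_nonneg (Real.exp_pos _).le]
      refine mul_le_mul_of_nonneg_left ?_ (Real.exp_pos _).le
      refine ((F s).le_opNorm _).trans (mul_le_mul (hb s) ?_ (norm_nonneg _) hK)
      rw [← dist_eq_norm]
      exact y.dist_coe_le_dist s
    rw [intervalIntegral.integral_mul_const] at hle
    calc _ ≤ Real.exp (-(c * (t - t₀))) * ((∫ s in t₀..t, Real.exp (c * (s - t₀))) *
            (K * dist y z)) := mul_le_mul_of_nonneg_left hle (Real.exp_pos _).le
      _ = (Real.exp (-(c * (t - t₀))) * ∫ s in t₀..t, Real.exp (c * (s - t₀))) *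
            (K * dist y z) := by ring
      _ ≤ 1 / c * (K * dist y z) := mul_le_mul_of_nonneg_right (hint t ht) (by positivity)
      _ = _ := by ring
  have hΨc : ∀ y, Continuous (Ψ y) := fun y => by
    have := intervalIntegral.continuous_primitive
      (fun a b => (hcont y).intervalIntegrable (μ := MeasureTheory.volume) a b) t₀
    fun_prop
  have hΨb : ∀ y, ∀ t, ‖Ψ y (max t t₀)‖ ≤ ‖x₀‖ + K / c * dist y 0 := by
    intro y t
    have ht := le_max_right t t₀
    simp only [Ψ]
    rw [norm_smul, Real.norm_of_nonneg (Real.exp_pos _).le]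
    refine (mul_le_mul_of_nonneg_left (norm_add_le _ _) (Real.exp_pos _).le).trans ?_
    rw [mul_add]
    refine add_le_add (mul_le_of_le_one_left (norm_nonneg _) ?_) ?_
    · rw [Real.exp_le_one_iff]
      nlinarith
    · simpa using hest y 0 _ ht
  -- Replacing `t` by `max t t₀` freezes the function to the left of `t₀`, where the weight gives no
  -- bound.
  let Φ : (ℝ →ᵇ E) → (ℝ →ᵇ E) := fun y => BoundedContinuousFunction.ofNormedAddCommGroup
    (fun t => Ψ y (max t t₀)) ((hΨc y).comp (by fun_prop)) _ (hΨb y)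
  have hΦ : ContractingWith (K / c).toNNReal Φ := by
    have hKc : 0 ≤ K / c := by positivity
    refine ⟨?_, LipschitzWith.of_dist_le_mul fun y z => ?_⟩
    · rw [Real.toNNReal_lt_one, div_lt_one hcpos]
      linarith
    · rw [Real.coe_toNNReal _ hKc, BoundedContinuousFunction.dist_le (by positivity)]
      intro t
      change dist (Ψ y (max t t₀)) (Ψ z (max t t₀)) ≤ K / c * dist y z
      have ht := le_max_right t t₀
      refine le_trans (le_of_eq ?_) (hest y z _ ht)
      simp only [Ψ]
      rw [dist_eq_norm, ← smul_sub, norm_smul, Real.norm_of_nonneg (Real.exp_pos _).le,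
        add_sub_add_left_eq_sub, ← intervalIntegral.integral_sub
          ((hcont y).intervalIntegrable _ _) ((hcont z).intervalIntegrable _ _)]
      simp only [map_sub, smul_sub]
  set y := ContractingWith.fixedPoint Φ hΦ
  have hy : ∀ t, t₀ ≤ t → y t = Ψ y t := fun t ht => by
    have h : Φ y = y := hΦ.fixedPoint_isFixedPt
    have h2 : Φ y t = Ψ y (max t t₀) := rfl
    rw [max_eq_left ht, h] at h2
    exact h2
  refine ⟨fun t => x₀ + ∫ s in t₀..t, Real.exp (c * (s - t₀)) • F s (y s), by simp,
    fun t ht => ?_⟩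
  have hd := ((intervalIntegral.integral_hasDerivAt_right ((hcont y).intervalIntegrable t₀ t)
    ((hcont y).stronglyMeasurableAtFilter _ _) (hcont y).continuousAt).const_add
      x₀).hasDerivWithinAt (s := Ici t₀)
  refine hd.congr_deriv ?_
  rw [← map_smul, hy t ht]
  simp only [Ψ]
  rw [smul_smul, ← Real.exp_add, add_neg_cancel, Real.exp_zero, one_smul]

/-! ### The persistence filter: existence and two-sided bounds. -/

/-- Existence for the scalar filter equation. -/
theorem exists_filter {f : ℝ → ℝ} (hf : ContinuousOn f (Ici 0)) (l R₀ : ℝ) :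
    ∃ R : ℝ → ℝ, R 0 = R₀ ∧ ∀ t ∈ Ici (0 : ℝ), HasDerivWithinAt R (-l * R t + f t) (Ici 0) t := by
  have hc : Continuous fun s => Real.exp (l * s) * f (max s 0) := by
    have : Continuous fun s => f (max s 0) :=
      hf.comp_continuous (by fun_prop) fun s => mem_Ici.2 (le_max_right _ _)
    exact (by fun_prop : Continuous fun s => Real.exp (l * s)).mul this
  refine ⟨fun t => Real.exp (-(l * t)) * (R₀ + ∫ s in (0 : ℝ)..t, Real.exp (l * s) * f (max s 0)),
    by simp, fun t ht => ?_⟩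
  have h1 := (intervalIntegral.integral_hasDerivAt_right (hc.intervalIntegrable 0 t)
    (hc.stronglyMeasurableAtFilter _ _) hc.continuousAt).const_add R₀
  have h2 := ((hasDerivAt_id t).const_mul l).fun_neg.exp
  refine ((h2.mul h1).hasDerivWithinAt).congr_deriv ?_
  have h3 : Real.exp (-(l * t)) * Real.exp (l * t) = 1 := by rw [← Real.exp_add]; simp
  rw [max_eq_left ht]
  simp only [id]
  linear_combination f t * h3

section Filter

variable {f R : ℝ → ℝ} {l : ℝ}

/-- The variation of constants formula, as a derivative. -/
theorem filter_hasDerivWithinAt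
    (hR : ∀ t ∈ Ici (0 : ℝ), HasDerivWithinAt R (-l * R t + f t) (Ici 0) t) {t : ℝ}
    (ht : t ∈ Ici (0 : ℝ)) :
    HasDerivWithinAt (fun s => Real.exp (l * s) * R s) (Real.exp (l * t) * f t) (Ici 0) t := by
  have h2 := (((hasDerivAt_id t).const_mul l).exp).hasDerivWithinAt (s := Ici 0)
  refine (h2.mul (hR t ht)).congr_deriv ?_
  simp only [id]
  ring

/-- `R - C / l` solves the filter equation with the nonpositive input `f - C`, so it decreases after
multiplication by `exp (l t)`. -/
theorem filter_le (hl : 0 < l)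
    (hR : ∀ t ∈ Ici (0 : ℝ), HasDerivWithinAt R (-l * R t + f t) (Ici 0) t) {C : ℝ}
    (hC : ∀ t ∈ Ici (0 : ℝ), f t ≤ C) {t : ℝ} (ht : t ∈ Ici (0 : ℝ)) :
    R t ≤ |R 0 - C / l| + C / l := by
  have hd : ∀ s ∈ Ici (0 : ℝ), HasDerivWithinAt (fun s => Real.exp (l * s) * (R s - C / l))
      (Real.exp (l * s) * (f s - C)) (Ici 0) s := fun s hs => by
    refine filter_hasDerivWithinAt (R := fun s => R s - C / l) (f := fun s => f s - C) (l := l)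
      (fun s hs => ((hR s hs).sub_const _).congr_deriv ?_) hs
    field_simp
    ring
  have hanti : AntitoneOn (fun s => Real.exp (l * s) * (R s - C / l)) (Ici 0) := by
    refine antitoneOn_of_hasDerivWithinAt_nonpos (convex_Ici 0)
      (fun s hs => (hd s hs).continuousWithinAt)
      (fun s hs => (hd s (interior_subset hs)).mono interior_subset) fun s hs => ?_
    exact mul_nonpos_of_nonneg_of_nonpos (Real.exp_pos _).le
      (sub_nonpos.2 (hC s (interior_subset hs)))
  have h := hanti (mem_Ici.2 le_rfl) ht ht
  simp only [mul_zero, Real.exp_zero, one_mul] at h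
  have he : 1 ≤ Real.exp (l * t) := Real.one_le_exp (mul_nonneg hl.le ht)
  have habs : R t - C / l ≤ |R 0 - C / l| := by
    by_contra! hlt
    have h0 := abs_nonneg (R 0 - C / l)
    have h1 := le_abs_self (R 0 - C / l)
    nlinarith
  linarith

/-- In the variation of constants formula the kernel `exp (-l (t - τ))` is smallest at the left end
`τ = s` of the window. -/
theorem filter_sub_ge (hl : 0 < l) (hf : ContinuousOn f (Ici 0)) (hf0 : ∀ t, 0 ≤ f t)
    (hR : ∀ t ∈ Ici (0 : ℝ), HasDerivWithinAt R (-l * R t + f t) (Ici 0) t) {s t : ℝ}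
    (hs : 0 ≤ s) (hst : s ≤ t) :
    Real.exp (-(l * (t - s))) * (R s + ∫ τ in s..t, f τ) ≤ R t := by
  have hsub : Icc s t ⊆ Ici 0 := fun x hx => hs.trans hx.1
  have hci : ContinuousOn (fun s => Real.exp (l * s) * f s) (Icc s t) :=
    (by fun_prop : Continuous fun s => Real.exp (l * s)).continuousOn.mul (hf.mono hsub)
  have hii : IntervalIntegrable (fun s => Real.exp (l * s) * f s) MeasureTheory.volume s t :=
    hci.intervalIntegrable_of_Icc hst
  have hif : IntervalIntegrable f MeasureTheory.volume s t :=
    (hf.mono hsub).intervalIntegrable_of_Icc hst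
  have hFTC := intervalIntegral.integral_eq_sub_of_hasDerivAt_of_le hst
    (fun x hx => ((filter_hasDerivWithinAt hR (hsub hx)).continuousWithinAt).mono hsub)
    (fun x hx => (filter_hasDerivWithinAt hR (hsub (Ioo_subset_Icc_self hx))).hasDerivAt
      (Ici_mem_nhds (hs.trans_lt hx.1))) hii
  have hmono : ∫ τ in s..t, Real.exp (l * s) * f τ ≤ ∫ τ in s..t, Real.exp (l * τ) * f τ := by
    refine intervalIntegral.integral_mono_on hst (hif.const_mul _) hii fun x hx => ?_
    refine mul_le_mul_of_nonneg_right (Real.exp_le_exp.2 ?_) (hf0 x)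
    exact mul_le_mul_of_nonneg_left hx.1 hl.le
  rw [intervalIntegral.integral_const_mul, hFTC] at hmono
  have he : Real.exp (-(l * (t - s))) = Real.exp (l * s) * Real.exp (-(l * t)) := by
    rw [← Real.exp_add]
    ring_nf
  have h1 : Real.exp (-(l * t)) * Real.exp (l * t) = 1 := by rw [← Real.exp_add]; simp
  have h2 := mul_le_mul_of_nonneg_left hmono (Real.exp_pos (-(l * t))).le
  calc _ = Real.exp (-(l * t)) * (Real.exp (l * s) * ∫ τ in s..t, f τ) +
        Real.exp (-(l * t)) * (Real.exp (l * s) * R s) := by rw [he]; ring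
    _ ≤ Real.exp (-(l * t)) * (Real.exp (l * t) * R t - Real.exp (l * s) * R s) +
        Real.exp (-(l * t)) * (Real.exp (l * s) * R s) := by linarith
    _ = R t := by linear_combination R t * h1

end Filter

/-- The filter output is bounded below if the excitation is persistent. -/
theorem filter_lower {g R : ℝ → ℝ} {l : ℝ} {q : ℕ} (hq : 1 ≤ q) (hl : 0 < l)
    (hg : ContinuousOn g (Ici 0)) (hPE : PersistentlyExciting g) (hR0 : 0 < R 0)
    (hR : ∀ t ∈ Ici (0 : ℝ), HasDerivWithinAt R (-l * R t + g t ^ (2 * q)) (Ici 0) t) :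
    ∃ c : ℝ, 0 < c ∧ ∀ t ∈ Ici (0 : ℝ), c ≤ R t := by
  obtain ⟨a₁, a₂, δ, ha₁, -, hδ, hpe⟩ := hPE
  have hf : ContinuousOn (fun t => g t ^ (2 * q)) (Ici 0) := hg.pow _
  have hf0 : ∀ t, 0 ≤ g t ^ (2 * q) := fun t => by rw [pow_mul]; positivity
  have hint0 : ∀ s t : ℝ, s ≤ t → 0 ≤ ∫ τ in s..t, g τ ^ (2 * q) := fun s t hst =>
    intervalIntegral.integral_nonneg hst fun x _ => hf0 x
  have hpos : ∀ t, 0 ≤ t → Real.exp (-(l * t)) * R 0 ≤ R t := fun t ht => by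
    have h := filter_sub_ge hl hf hf0 hR le_rfl ht
    rw [sub_zero] at h
    have := hint0 0 t ht
    have := Real.exp_pos (-(l * t))
    nlinarith
  -- With this threshold `y * δ = a₁ / 2`, so `g ^ 2 - y` still has integral at least `a₁ / 2` over
  -- each window. The pointwise bound `y ^ (q - 1) * (g ^ 2 - y) ≤ g ^ (2 * q)` then passes the
  -- excitation on to the higher power.
  set y : ℝ := a₁ / (2 * δ) with hy
  have hypos : 0 < y := by positivity
  have hlow : ∀ s, 0 ≤ s → y ^ (q - 1) * (a₁ / 2) ≤ ∫ τ in s..(s + δ), g τ ^ (2 * q) := by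
    intro s hs
    have hsub : Icc s (s + δ) ⊆ Ici 0 := fun x hx => hs.trans hx.1
    have hsδ : s ≤ s + δ := by linarith
    have h2 : IntervalIntegrable (fun τ => g τ ^ 2) MeasureTheory.volume s (s + δ) :=
      ((hg.pow 2).mono hsub).intervalIntegrable_of_Icc hsδ
    calc y ^ (q - 1) * (a₁ / 2) ≤ y ^ (q - 1) * ((∫ τ in s..(s + δ), g τ ^ 2) - y * δ) := by
          refine mul_le_mul_of_nonneg_left ?_ (by positivity)
          have : y * δ = a₁ / 2 := by rw [hy]; field_simp
          linarith [(hpe s hs).1]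
      _ = ∫ τ in s..(s + δ), y ^ (q - 1) * (g τ ^ 2 - y) := by
          rw [intervalIntegral.integral_const_mul, intervalIntegral.integral_sub h2 (by simp)]
          simp only [intervalIntegral.integral_const, smul_eq_mul]
          ring
      _ ≤ _ := by
          refine intervalIntegral.integral_mono_on hsδ ((h2.sub (by simp)).const_mul _)
            ((hf.mono hsub).intervalIntegrable_of_Icc hsδ) fun x _ => ?_
          rw [pow_mul]
          rcases le_total (g x ^ 2) y with h | h
          · exact (mul_nonpos_of_nonneg_of_nonpos (by positivity) (by linarith)).trans
              (by positivity)
          · calc y ^ (q - 1) * (g x ^ 2 - y) ≤ (g x ^ 2) ^ (q - 1) * (g x ^ 2) := by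
                  gcongr
                  linarith
              _ = _ := by rw [← pow_succ, Nat.sub_add_cancel hq]
  -- The first constant serves `t ≤ δ`, where the initial value has not decayed much; the second
  -- serves `t ≥ δ`, where a full window `[t - δ, t]` is available.
  refine ⟨min (Real.exp (-(l * δ)) * R 0) (Real.exp (-(l * δ)) * (y ^ (q - 1) * (a₁ / 2))),
    by positivity, fun t ht => ?_⟩
  have ht' : 0 ≤ t := ht
  rcases le_total t δ with h | h
  · refine (min_le_left _ _).trans (le_trans ?_ (hpos t ht))
    gcongr
  · refine (min_le_right _ _).trans (le_trans ?_
      (filter_sub_ge hl hf hf0 hR (sub_nonneg.2 h) (sub_le_self _ hδ.le)))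
    rw [sub_sub_cancel]
    have h1 := hlow (t - δ) (sub_nonneg.2 h)
    rw [sub_add_cancel] at h1
    have h2 := hpos (t - δ) (sub_nonneg.2 h)
    have h3 : 0 < Real.exp (-(l * (t - δ))) * R 0 := by positivity
    refine mul_le_mul_of_nonneg_left ?_ (Real.exp_pos _).le
    linarith

/-- The filter output inherits the bounds on the derivatives of the excitation. -/
theorem filter_bd {f R : ℝ → ℝ} {l : ℝ} {d : ℕ} (hf : BD d f)
    (hR : ∀ t ∈ Ici (0 : ℝ), HasDerivWithinAt R (-l * R t + f t) (Ici 0) t)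
    (hb : ∃ C : ℝ, ∀ t ∈ Ici (0 : ℝ), |R t| ≤ C) : BD d R := by
  induction d with
  | zero => exact ⟨fun t ht => (hR t ht).continuousWithinAt, hb⟩
  | succ d ih => exact ⟨hb, _, hR, ((ih hf.pred).const_mul _).add hf.pred⟩

namespace BlockData

variable {m : ℕ} (D : BlockData m)

theorem two_le_expo : 2 ≤ D.expo := le_max_left _ _

/-- Evenness makes the filter input `g ^ k` a power of `g ^ 2`, hence nonnegative and controlled
from below by the excitation. -/
theorem even_expo : Even D.expo := by
  unfold expo
  rcases Nat.eq_zero_or_pos (Nat.clog 2 D.rmax) with h | h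
  · rw [h]; decide
  · rcases max_cases 2 (2 ^ Nat.clog 2 D.rmax) with ⟨e, -⟩ | ⟨e, -⟩ <;> rw [e]
    · decide
    · exact (even_two.pow_of_ne_zero h.ne')

/-- This is why the exponent grows with the block size: a factor `g_j` must survive `r_j` steps of
the recursion `augCoeff`. -/
theorem r_le_expo (j : Fin D.p) : D.r j ≤ D.expo :=
  (Finset.le_sup (f := D.r) (Finset.mem_univ j)).trans
    ((Nat.le_pow_clog one_lt_two _).trans (le_max_right _ _))

variable {D} {g : Fin m → ℝ → ℝ} {lam : Fin D.p → ℝ}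

theorem IsPersistenceFilter.bounds {R : Fin D.p → ℝ → ℝ} (hR : D.IsPersistenceFilter g lam R)
    (hl : ∀ j, 0 < lam j) {d : ℕ} (hg : ∀ q, BD d (g q)) (hPE : ∀ q, PersistentlyExciting (g q))
    (j : Fin D.p) :
    ∃ c C : ℝ, 0 < c ∧ (∀ t ∈ Ici (0 : ℝ), c ≤ R j t ∧ R j t ≤ C) ∧ BD d (R j) := by
  obtain ⟨q, hq⟩ := D.even_expo
  have hq2 : D.expo = 2 * q := by omega
  have hq1 : 1 ≤ q := by have := D.two_le_expo; omega
  have hRd := (hR j).2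
  obtain ⟨c, hc, hcR⟩ := filter_lower (q := q) hq1 (hl j) (hg (D.inp j)).continuousOn
    (hPE (D.inp j)) (hR j).1 (by rw [← hq2]; exact hRd)
  have hfb := (hg (D.inp j)).pow D.expo
  obtain ⟨C, hC⟩ := hfb.bdd
  have hub := fun t (ht : t ∈ Ici (0 : ℝ)) => filter_le (hl j) hRd
    (fun s hs => (le_abs_self _).trans (hC s hs)) ht
  refine ⟨c, |R j 0 - C / lam j| + C / lam j, hc, fun t ht => ⟨hcR t ht, hub t ht⟩, filter_bd hfb hRd ⟨|R j 0 - C / lam j| + C / lam j, fun t ht => ?_⟩⟩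
  rw [abs_of_pos (hc.trans_le (hcR t ht))]
  exact hub t ht

theorem exists_persistenceFilter {d : ℕ} (hg : ∀ q, BD d (g q)) (R₀ : Fin D.p → ℝ)
    (hR₀ : ∀ j, 0 < R₀ j) :
    ∃ R : Fin D.p → ℝ → ℝ, D.IsPersistenceFilter g lam R ∧ ∀ j, R j 0 = R₀ j := by
  choose R hR0 hR using fun j : Fin D.p =>
    exists_filter ((hg (D.inp j)).pow D.expo).continuousOn (lam j) (R₀ j)
  exact ⟨R, fun j => ⟨by rw [hR0 j]; exact hR₀ j, hR j⟩, hR0⟩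

end BlockData

/-! ### The difference between augmented and original states. -/

namespace BlockData

variable {m : ℕ} (D : BlockData m)

/-- The matrix of the closed loop in the augmented states, when `h j` is the damping of block
`j`. -/
noncomputable def augMatrix (h : Fin D.p → ℝ → ℝ) (t : ℝ) : Matrix D.Idx D.Idx ℝ :=
  D.Ahat - Matrix.diagonal fun a => h a.1 t

/-- The coefficients of `Ω_i - z_i` (block `j`, position `i`) as a linear function of the augmented
states. -/
noncomputable def augCoeff (h : Fin D.p → ℝ → ℝ) (j : Fin D.p) : ℕ → D.Idx → ℝ → ℝ
  | 0 => fun _ _ => 0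
  -- Since `Ω_1 = z_1`, the coupling terms cancel and `Ω_{i+1} - z_{i+1} = d/dt (Ω_i - z_i) + h_j
  -- Ω_i`. Inserting the linear form at stage `i` and `Ω' = augMatrix Ω` gives these three summands.
  -- Stages count from 0, so stage `D.r j` lies one past the last position and describes the
  -- control.
  | i + 1 => fun b t => derivWithin (augCoeff h j i b) (Ici 0) t
      + ∑ a, augCoeff h j i a t * D.augMatrix h t a b
      + if b.1 = j ∧ (b.2 : ℕ) = i then h j t else 0

variable {D} {g : Fin m → ℝ → ℝ} {h : Fin D.p → ℝ → ℝ} {d k : ℕ}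

theorem bd_augMatrix (hh : ∀ j, BD d (h j)) (a b : D.Idx) : BD d fun t => D.augMatrix h t a b := by
  by_cases hab : a = b
  · subst hab
    refine ((BD.const d (D.Ahat a a)).add ((hh a.1).const_mul (-1))).congr fun t _ => ?_
    simp [augMatrix]
    ring
  · refine (BD.const d (D.Ahat a b)).congr fun t _ => ?_
    simp [augMatrix, hab]

/-- Stage 1 is the damping itself, with `k` powers of `g` and `d` derivatives; each later stage
differentiates once and loses one of each. -/
theorem divPow_augCoeff (hg : ∀ q, BD d (g q)) (hh : ∀ j, DivPow (g (D.inp j)) k d (h j))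
    (j : Fin D.p) (hrd : D.r j ≤ d + 1) (hrk : D.r j ≤ k) (i : ℕ) (hi : i ≤ D.r j) (b : D.Idx) :
    DivPow (g (D.inp j)) (k + 1 - i) (d + 1 - i) (D.augCoeff h j i b) := by
  induction i generalizing b with
  | zero => exact DivPow.zero
  | succ i ih =>
    have hite : DivPow (g (D.inp j)) (k + 1 - (i + 1)) (d + 1 - (i + 1))
        fun t => if b.1 = j ∧ (b.2 : ℕ) = i then h j t else 0 := by
      split_ifs
      · exact (hh j).mono ((hg _).mono (by omega)) (by omega) (by omega)
      · exact DivPow.zero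
    refine DivPow.add (DivPow.add ?_ (DivPow.sum _ fun a _ => ?_)) hite
    -- At stage 0 the nominal order `d + 1` exceeds the smoothness of `g`, but there the
    -- coefficients vanish.
    · rcases Nat.eq_zero_or_pos i with rfl | hi0
      · exact DivPow.zero.congr fun t _ => by simp [augCoeff]
      · have hc := ih (by omega) b
        rw [show k + 1 - i = (k + 1 - (i + 1)) + 1 by omega,
          show d + 1 - i = (d + 1 - (i + 1)) + 1 by omega] at hc
        obtain ⟨c', hc', hd'⟩ := hc.hasDerivWithinAt ((hg _).mono (by omega))
        exact hd'.congr fun t ht => (hc' t ht).derivWithin (uniqueDiffOn_Ici 0 t ht)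
    · exact ((ih (by omega) a).mono ((hg _).mono (by omega)) (by omega) (by omega)).mul
        ((bd_augMatrix (fun j => (hh j).bd (hg _)) a b).mono (by omega))

theorem hasDerivWithinAt_augCoeff (hg : ∀ q, BD d (g q))
    (hh : ∀ j, DivPow (g (D.inp j)) k d (h j)) (j : Fin D.p) (hrd : D.r j ≤ d + 1)
    (hrk : D.r j ≤ k) (i : ℕ) (hi : i < D.r j) (b : D.Idx) {t : ℝ} (ht : t ∈ Ici (0 : ℝ)) :
    HasDerivWithinAt (D.augCoeff h j i b) (D.augCoeff h j (i + 1) b t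
      - ∑ a, D.augCoeff h j i a t * D.augMatrix h t a b
      - if b.1 = j ∧ (b.2 : ℕ) = i then h j t else 0) (Ici 0) t := by
  have hd : DifferentiableWithinAt ℝ (D.augCoeff h j i b) (Ici 0) t := by
    rcases Nat.eq_zero_or_pos i with rfl | hi0
    · exact differentiableWithinAt_const _
    · have hc := divPow_augCoeff hg hh j hrd hrk i hi.le b
      rw [show k + 1 - i = (k - i) + 1 by omega, show d + 1 - i = (d - i) + 1 by omega] at hc
      obtain ⟨c', hc', -⟩ := hc.hasDerivWithinAt ((hg _).mono (by omega))
      exact (hc' t ht).differentiableWithinAt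
  refine hd.hasDerivWithinAt.congr_deriv ?_
  simp only [augCoeff]
  ring

theorem Ahat_eq_zero {a b : D.Idx} (hab : b.1 < a.1) : D.Ahat a b = 0 := by
  simp [Ahat, block, hab.ne', hab.asymm]

/-- Multiplication by the block triangular `augMatrix` leads from block `j` to later blocks or,
inside block `j`, at most one position further. The full last row of the companion block is not
reached as long as the stage is at most `D.r j`. -/
theorem augCoeff_eq_zero (h : Fin D.p → ℝ → ℝ) (j : Fin D.p) (i : ℕ) (hi : i ≤ D.r j)
    (b : D.Idx) (hb : ¬ ((b.1 = j ∧ (b.2 : ℕ) < i) ∨ j < b.1)) {t : ℝ} (ht : t ∈ Ici (0 : ℝ)) :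
    D.augCoeff h j i b t = 0 := by
  induction i generalizing b t with
  | zero => rfl
  | succ i ih =>
    have h1 : derivWithin (D.augCoeff h j i b) (Ici 0) t = 0 := by
      rw [derivWithin_congr (f := fun _ => 0) (fun s hs => ih (by omega) b (by grind) hs)
        (ih (by omega) b (by grind) ht)]
      simp
    have h2 : ∀ a, D.augCoeff h j i a t * D.augMatrix h t a b = 0 := by
      intro a
      by_cases ha : (a.1 = j ∧ (a.2 : ℕ) < i) ∨ j < a.1
      · obtain ⟨ka, la⟩ := a
        obtain ⟨kb, lb⟩ := b
        have hne : (⟨ka, la⟩ : D.Idx) ≠ ⟨kb, lb⟩ := by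
          intro he
          obtain ⟨rfl, he⟩ := Sigma.mk.inj_iff.1 he
          obtain rfl := eq_of_heq he
          grind
        rw [augMatrix, Matrix.sub_apply, Matrix.diagonal_apply_ne _ hne, sub_zero]
        simp only at ha hb
        rcases ha with ⟨rfl, hl⟩ | ha
        · push Not at hb
          rcases lt_or_eq_of_le hb.2 with hlt | rfl
          · rw [Ahat_eq_zero hlt, mul_zero]
          · have := hb.1 rfl
            simp only [Ahat, block, Matrix.of_apply, if_true]
            rw [if_neg (by omega), if_neg (by omega), mul_zero]
        · rw [Ahat_eq_zero, mul_zero]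
          push Not at hb
          exact hb.2.trans_lt ha
      · rw [ih (by omega) a ha ht, zero_mul]
    simp only [augCoeff]
    rw [h1, Finset.sum_eq_zero fun a _ => h2 a, if_neg]
    · simp
    · grind

end BlockData

/-! ### The closed loop in augmented coordinates. -/

namespace BlockData

variable {m : ℕ} {D : BlockData m}

theorem sum_eq_add_sum_Ioi {p : ℕ} (f : Fin p → ℝ) (j : Fin p) (hf : ∀ s < j, f s = 0) :
    ∑ s, f s = f j + ∑ s ∈ Finset.Ioi j, f s := by
  rw [← Finset.sum_insert (by simp)]
  symm
  refine Finset.sum_subset (Finset.subset_univ _) fun s _ hs => hf s ?_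
  simp only [Finset.mem_insert, Finset.mem_Ioi, not_or] at hs
  exact lt_of_le_of_ne (not_lt.1 hs.2) hs.1

theorem Ahat_mulVec (v : D.Idx → ℝ) (j : Fin D.p) (l : Fin (D.r j)) :
    (D.Ahat *ᵥ v) ⟨j, l⟩ = ∑ i, D.block j j l i * v ⟨j, i⟩
      + ∑ s ∈ Finset.Ioi j, ∑ i, D.block j s l i * v ⟨s, i⟩ := by
  rw [Matrix.mulVec, dotProduct, Fintype.sum_sigma, sum_eq_add_sum_Ioi _ j]
  · rfl
  · intro s hs
    exact Finset.sum_eq_zero fun i _ => by rw [Ahat_eq_zero (by exact hs), zero_mul]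

theorem sum_block_mul_of_lt {j s : Fin D.p} (hjs : j < s) (l : Fin (D.r j))
    (v : Fin (D.r s) → ℝ) : ∑ i, D.block j s l i * v i = D.β j s l * v (D.fst s) := by
  rw [Finset.sum_eq_single (D.fst s)]
  · simp [block, hjs.ne, hjs, fst]
  · intro i _ hi
    have : (i : ℕ) ≠ 0 := fun h => hi (Fin.ext h)
    simp [block, hjs.ne, this]
  · simp

theorem Ahat_mulVec_of_lt (v : D.Idx → ℝ) (j : Fin D.p) {l l' : Fin (D.r j)}
    (hl : (l' : ℕ) = (l : ℕ) + 1) :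
    (D.Ahat *ᵥ v) ⟨j, l⟩ = v ⟨j, l'⟩ + ∑ s ∈ Finset.Ioi j, D.β j s l * v ⟨s, D.fst s⟩ := by
  rw [Ahat_mulVec]
  congr 1
  · rw [Finset.sum_eq_single l']
    · simp only [block, Matrix.of_apply, if_true]
      rw [if_neg (by have := l'.2; omega), if_pos hl, one_mul]
    · intro i _ hi
      simp only [block, Matrix.of_apply, if_true]
      rw [if_neg (by have := l'.2; omega), if_neg, zero_mul]
      exact fun h => hi (Fin.ext (h.trans hl.symm))
    · simp
  · exact Finset.sum_congr rfl fun s hs =>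
      sum_block_mul_of_lt (Finset.mem_Ioi.1 hs) l fun i => v ⟨s, i⟩

theorem Ahat_mulVec_lst (v : D.Idx → ℝ) (j : Fin D.p) :
    (D.Ahat *ᵥ v) ⟨j, D.lst j⟩ = - ∑ i, D.α j i.rev * v ⟨j, i⟩
      + ∑ s ∈ Finset.Ioi j, D.β j s (D.lst j) * v ⟨s, D.fst s⟩ := by
  rw [Ahat_mulVec]
  congr 1
  · rw [← Finset.sum_neg_distrib]
    refine Finset.sum_congr rfl fun i _ => ?_
    have : ((D.lst j : ℕ)) + 1 = D.r j := Nat.sub_add_cancel (D.r_pos j)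
    simp [block, this]
  · exact Finset.sum_congr rfl fun s hs =>
      sum_block_mul_of_lt (Finset.mem_Ioi.1 hs) (D.lst j) fun i => v ⟨s, i⟩

theorem exists_succ_or_eq_lst (j : Fin D.p) (l : Fin (D.r j)) :
    (∃ l' : Fin (D.r j), (l' : ℕ) = (l : ℕ) + 1) ∨ l = D.lst j := by
  by_cases h : (l : ℕ) + 1 < D.r j
  · exact Or.inl ⟨⟨_, h⟩, rfl⟩
  · refine Or.inr (Fin.ext ?_)
    have := l.2
    simp only [lst]
    omega

section Canonical

variable {n : ℕ} {A : Matrix (Fin n) (Fin n) ℝ} {B : Matrix (Fin n) (Fin m) ℝ}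
  {T : Matrix D.Idx (Fin n) ℝ}

theorem IsCanonicalForm.mul_comm (hT : D.IsCanonicalForm A B T) : T * A = D.Ahat * T := by
  obtain ⟨⟨S, -, hST, hA⟩, -⟩ := hT
  rw [← hA, Matrix.mul_assoc, hST, Matrix.mul_one]

theorem IsCanonicalForm.r_le (hT : D.IsCanonicalForm A B T) (j : Fin D.p) : D.r j ≤ n := by
  obtain ⟨⟨S, hTS, hST, -⟩, -⟩ := hT
  have hcard : Fintype.card D.Idx = n := by
    have e : (D.Idx → ℝ) ≃ₗ[ℝ] (Fin n → ℝ) := Matrix.toLin'OfInv hTS hST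
    simpa using e.finrank_eq
  rw [← hcard]
  simpa using Fintype.card_le_of_injective (fun i : Fin (D.r j) => (⟨j, i⟩ : D.Idx))
    fun _ _ hab => by simpa using hab

theorem IsCanonicalForm.input_apply (hT : D.IsCanonicalForm A B T) (G u : Fin m → ℝ)
    (hu : ∀ q, (∀ j, q ≠ D.inp j) → u q = 0) (j : Fin D.p) (l : Fin (D.r j)) :
    (T *ᵥ ((B * Matrix.diagonal G) *ᵥ u)) ⟨j, l⟩ =
      if l = D.lst j then G (D.inp j) * u (D.inp j) else 0 := by
  rw [Matrix.mulVec_mulVec, ← Matrix.mul_assoc, ← Matrix.mulVec_mulVec]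
  have h1 : ∀ q, (T * B) ⟨j, l⟩ q * (Matrix.diagonal G *ᵥ u) q =
      if q = D.inp j then (if l = D.lst j then G (D.inp j) * u (D.inp j) else 0) else 0 := by
    intro q
    rw [Matrix.mulVec_diagonal]
    by_cases hq : ∃ s, q = D.inp s
    · obtain ⟨s, rfl⟩ := hq
      rw [congrFun (hT.2 s) ⟨j, l⟩]
      by_cases hs : s = j
      · subst hs
        by_cases hl : l = D.lst s
        · subst hl; simp
        · simp [hl]
      · have : (⟨j, l⟩ : D.Idx) ≠ ⟨s, D.lst s⟩ := fun h => hs (congrArg Sigma.fst h).symm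
        simp [this, hs]
    · push Not at hq
      rw [if_neg (hq j), hu q hq]
      simp
  simp only [Matrix.mulVec, dotProduct] at h1 ⊢
  rw [Finset.sum_congr rfl fun q _ => h1 q]
  simp

end Canonical

/-- The recursion `augCoeff` is designed for this: along a solution, differentiating the linear form
of stage `i` yields that of stage `i + 1` up to the damping term. -/
theorem hasDerivWithinAt_sum_augCoeff {g : Fin m → ℝ → ℝ} {h : Fin D.p → ℝ → ℝ} {d k : ℕ}
    (hg : ∀ q, BD d (g q)) (hh : ∀ j, DivPow (g (D.inp j)) k d (h j)) (j : Fin D.p)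
    (hrd : D.r j ≤ d + 1) (hrk : D.r j ≤ k) (i : Fin (D.r j)) {t₀ : ℝ} (ht₀ : 0 ≤ t₀)
    {y : D.Idx → ℝ → ℝ} {t : ℝ} (ht : t ∈ Ici t₀)
    (hy : ∀ a, HasDerivWithinAt (y a) ((D.augMatrix h t *ᵥ fun b => y b t) a) (Ici t₀) t) :
    HasDerivWithinAt (fun t => ∑ b, D.augCoeff h j i b t * y b t)
      (∑ b, D.augCoeff h j (i + 1) b t * y b t - h j t * y ⟨j, i⟩ t) (Ici t₀) t := by
  have hd := HasDerivWithinAt.fun_sum (u := Finset.univ) fun b _ =>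
    ((hasDerivWithinAt_augCoeff hg hh j hrd hrk i i.2 b (mem_Ici.2 (ht₀.trans ht))).mono
      (Ici_subset_Ici.2 ht₀)).mul (hy b)
  refine hd.congr_deriv ?_
  have h1 : ∑ b, (if b.1 = j ∧ (b.2 : ℕ) = i then h j t else 0) * y b t = h j t * y ⟨j, i⟩ t := by
    rw [Finset.sum_eq_single ⟨j, i⟩]
    · simp
    · rintro ⟨s, l⟩ - hne
      rw [if_neg, zero_mul]
      rintro ⟨hs, hl⟩
      simp only at hs hl
      subst hs
      exact hne (by rw [Fin.ext hl])
    · simp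
  have h2 : ∑ b, (∑ a, D.augCoeff h j i a t * D.augMatrix h t a b) * y b t =
      ∑ b, D.augCoeff h j i b t * (D.augMatrix h t *ᵥ fun b => y b t) b := by
    simp only [Matrix.mulVec, dotProduct, Finset.sum_mul, Finset.mul_sum]
    rw [Finset.sum_comm]
    simp only [mul_assoc]
  rw [← h1, Finset.sum_add_distrib, ← h2]
  simp only [sub_mul, Finset.sum_sub_distrib]
  ring

theorem augMatrix_mulVec (h : Fin D.p → ℝ → ℝ) (t : ℝ) (v : D.Idx → ℝ) (a : D.Idx) :
    (D.augMatrix h t *ᵥ v) a = (D.Ahat *ᵥ v) a - h a.1 t * v a := by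
  simp [augMatrix, Matrix.sub_mulVec, Matrix.mulVec_diagonal]

/-- The damping coefficients `g_j^k / (2 R_j)`. -/
noncomputable def damping (D : BlockData m) (g : Fin m → ℝ → ℝ) (R : Fin D.p → ℝ → ℝ)
    (j : Fin D.p) (t : ℝ) : ℝ :=
  g (D.inp j) t ^ D.expo / (2 * R j t)

section Forward

variable {n : ℕ} {A : Matrix (Fin n) (Fin n) ℝ} {B : Matrix (Fin n) (Fin m) ℝ}
  {T : Matrix D.Idx (Fin n) ℝ} {g : Fin m → ℝ → ℝ} {R : Fin D.p → ℝ → ℝ} {t₀ : ℝ}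
  {x : ℝ → Fin n → ℝ} {u : ℝ → Fin m → ℝ} {Ω : (j : Fin D.p) → Fin (D.r j) → ℝ → ℝ}

theorem ClosedLoop.hasDerivWithinAt_z (hT : D.IsCanonicalForm A B T)
    (hc : D.ClosedLoop A B T g R t₀ x u Ω) (j : Fin D.p) (l : Fin (D.r j)) {t : ℝ}
    (ht : t ∈ Ici t₀) :
    HasDerivWithinAt (fun t => (T *ᵥ x t) ⟨j, l⟩) ((D.Ahat *ᵥ (T *ᵥ x t)) ⟨j, l⟩ +
      if l = D.lst j then g (D.inp j) t * u t (D.inp j) else 0) (Ici t₀) t := by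
  have h1 := hasDerivWithinAt_pi.1 (hc.plant t ht)
  have h2 := HasDerivWithinAt.fun_sum (u := Finset.univ) fun q _ =>
    (h1 q).const_mul (T ⟨j, l⟩ q)
  refine h2.congr_deriv ?_
  have h3 : (T *ᵥ (A *ᵥ x t + (B * Matrix.diagonal fun j => g j t) *ᵥ u t)) ⟨j, l⟩ =
      (D.Ahat *ᵥ (T *ᵥ x t)) ⟨j, l⟩ +
        if l = D.lst j then g (D.inp j) t * u t (D.inp j) else 0 := by
    rw [Matrix.mulVec_add, Pi.add_apply,
      hT.input_apply _ _ fun q hq => hc.control_unused q hq t ht, Matrix.mulVec_mulVec,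
      hT.mul_comm, ← Matrix.mulVec_mulVec]
  exact h3

/-- Before the last position this is the definition of the next augmented state. At the last one,
the derivative of `z` inside the feedback law contains `g_j u_j`, which cancels against the left
side; the law is thus a condition on `Ω` alone. -/
theorem ClosedLoop.hasDerivWithinAt_aug (hT : D.IsCanonicalForm A B T)
    (hc : D.ClosedLoop A B T g R t₀ x u Ω) (a : D.Idx) {t : ℝ} (ht : t ∈ Ici t₀) :
    HasDerivWithinAt (Ω a.1 a.2)
      ((D.augMatrix (D.damping g R) t *ᵥ fun b => Ω b.1 b.2 t) a) (Ici t₀) t := by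
  obtain ⟨j, l⟩ := a
  have hd := (hc.aug_diff j l t ht).hasDerivWithinAt
  refine hd.congr_deriv ?_
  rw [augMatrix_mulVec]
  rcases exists_succ_or_eq_lst j l with ⟨l', hl⟩ | rfl
  · rw [Ahat_mulVec_of_lt _ j hl, hc.aug_next j l l' hl t ht]
    simp only [damping]
    ring
  · have hz := hc.hasDerivWithinAt_z hT j (D.lst j) ht
    rw [if_pos rfl] at hz
    have hcl := hc.control j t ht
    have hsub := (hd.sub hz).derivWithin (uniqueDiffOn_Ici t₀ t ht)
    change derivWithin (fun τ => Ω j (D.lst j) τ - (T *ᵥ x τ) ⟨j, D.lst j⟩) _ _ = _ at hsub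
    rw [hsub, Ahat_mulVec_lst] at hcl
    rw [Ahat_mulVec_lst]
    simp only [mul_sub, Finset.sum_sub_distrib, ← hc.aug_first _ t ht] at hcl
    simp only [damping]
    linarith

theorem ClosedLoop.sub_eq (hT : D.IsCanonicalForm A B T)
    (hc : D.ClosedLoop A B T g R t₀ x u Ω) (ht₀ : 0 ≤ t₀) {d k : ℕ} (hg : ∀ q, BD d (g q))
    (hh : ∀ j, DivPow (g (D.inp j)) k d (D.damping g R j)) (hrd : ∀ j, D.r j ≤ d + 1)
    (hrk : ∀ j, D.r j ≤ k) (j : Fin D.p) (i : ℕ) (hi : i < D.r j) {t : ℝ} (ht : t ∈ Ici t₀) :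
    Ω j ⟨i, hi⟩ t - (T *ᵥ x t) ⟨j, ⟨i, hi⟩⟩ =
      ∑ b, D.augCoeff (D.damping g R) j i b t * Ω b.1 b.2 t := by
  induction i generalizing t with
  | zero => simp [augCoeff, show (⟨0, hi⟩ : Fin (D.r j)) = D.fst j from rfl, hc.aug_first j t ht]
  | succ i ih =>
    have hi' : i < D.r j := by omega
    have h1 := hasDerivWithinAt_sum_augCoeff hg hh j (hrd j) (hrk j) ⟨i, hi'⟩ ht₀
      (y := fun b => Ω b.1 b.2) ht fun a => hc.hasDerivWithinAt_aug hT a ht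
    have hd := (hc.aug_diff j ⟨i, hi'⟩ t ht).hasDerivWithinAt
    have hz := hc.hasDerivWithinAt_z hT j ⟨i, hi'⟩ ht
    have h2 := (hd.sub hz).congr (f₁ := fun t =>
      ∑ b, D.augCoeff (D.damping g R) j i b t * Ω b.1 b.2 t)
      (fun s hs => (ih hi' hs).symm) (ih hi' ht).symm
    -- The same function has been differentiated as `Ω_i - z_i` and as a linear form in `Ω`;
    -- equating the results gives the next stage.
    have h3 := (uniqueDiffOn_Ici t₀ t ht).eq_deriv _ h1 h2
    rw [if_neg (by simp only [lst, Fin.ext_iff]; omega),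
      Ahat_mulVec_of_lt _ j (l' := ⟨i + 1, hi⟩) rfl] at h3
    simp only [← hc.aug_first _ t ht] at h3
    have h4 := hc.aug_next j ⟨i, hi'⟩ ⟨i + 1, hi⟩ rfl t ht
    simp only [damping] at h3 ⊢
    linarith

end Forward

end BlockData

/-! ### Inverting the change of states, and existence of trajectories. -/

/-- Unipotent matrices with bounded entries have uniformly bounded inverses. -/
theorem exists_bound_unipotent {ι : Type*} [Fintype ι] (ρ : ι → ℕ) {K : ℝ} (hK : 0 ≤ K) :
    ∃ C : ℝ, 0 < C ∧ ∀ P : Matrix ι ι ℝ, (∀ a b, |P a b| ≤ K) →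
      (∀ a b, P a b ≠ 0 → ρ b < ρ a) → ∀ v w : ι → ℝ, (∀ a, v a - (P *ᵥ v) a = w a) →
        ∀ a, |v a| ≤ C * ‖w‖ := by
  have key : ∀ N : ℕ, ∃ C : ℝ, 0 < C ∧ ∀ P : Matrix ι ι ℝ, (∀ a b, |P a b| ≤ K) →
      (∀ a b, P a b ≠ 0 → ρ b < ρ a) → ∀ v w : ι → ℝ, (∀ a, v a - (P *ᵥ v) a = w a) →
        ∀ a, ρ a < N → |v a| ≤ C * ‖w‖ := by
    intro N
    induction N with
    | zero => exact ⟨1, one_pos, fun _ _ _ _ _ _ a ha => absurd ha (Nat.not_lt_zero _)⟩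
    | succ N ih =>
      obtain ⟨C, hC, h⟩ := ih
      -- A row of height at most `N` involves only entries of smaller height, which the induction
      -- bounds by `C * ‖w‖`; back substitution gives the new constant.
      refine ⟨1 + Fintype.card ι * (K * C), by positivity, fun P hP h0 v w hvw a ha => ?_⟩
      have hw : |w a| ≤ ‖w‖ := norm_le_pi_norm w a
      have hterm : ∀ b ∈ Finset.univ, |P a b * v b| ≤ K * C * ‖w‖ := fun b _ => by
        by_cases hb : P a b = 0
        · rw [hb, zero_mul, abs_zero]
          positivity
        · have h1 := h P hP h0 v w hvw b (by have := h0 a b hb; omega)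
          rw [abs_mul, mul_assoc]
          exact mul_le_mul (hP a b) h1 (abs_nonneg _) hK
      have hsum : |(P *ᵥ v) a| ≤ Fintype.card ι * (K * C * ‖w‖) := by
        refine (Finset.abs_sum_le_sum_abs _ _).trans ((Finset.sum_le_card_nsmul _ _ _ hterm).trans ?_)
        simp
      have : v a = w a + (P *ᵥ v) a := by linarith [hvw a]
      rw [this]
      refine (abs_add_le _ _).trans ?_
      linarith
  obtain ⟨C, hC, h⟩ := key (Finset.univ.sup ρ + 1)
  exact ⟨C, hC, fun P hP h0 v w hvw a =>
    h P hP h0 v w hvw a (Nat.lt_succ_of_le (Finset.le_sup (Finset.mem_univ a)))⟩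

namespace BlockData

variable {m : ℕ} {D : BlockData m}

/-- The matrix of `Ω - z` in terms of the augmented states. -/
noncomputable def augDiff (D : BlockData m) (h : Fin D.p → ℝ → ℝ) (t : ℝ) : Matrix D.Idx D.Idx ℝ :=
  Matrix.of fun a b => D.augCoeff h a.1 a.2 b t

/-- A height function on the positions for which `augDiff` is strictly triangular. -/
def height (D : BlockData m) (a : D.Idx) : ℕ := (D.p - a.1) * (D.rmax + 1) + a.2

/-- The factor `D.rmax + 1` exceeds every position, so `height` is lexicographic with later blocks
lowest, and the nonzero entries of `augDiff` point downwards. -/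
theorem height_lt_of_augDiff_ne_zero (h : Fin D.p → ℝ → ℝ) {t : ℝ} (ht : t ∈ Ici (0 : ℝ))
    (a b : D.Idx) (hab : D.augDiff h t a b ≠ 0) : D.height b < D.height a := by
  by_contra hlt
  refine hab (augCoeff_eq_zero h a.1 a.2 a.2.2.le b (fun hb => hlt ?_) ht)
  obtain ⟨j, l⟩ := a
  obtain ⟨s, i⟩ := b
  simp only [height] at hb ⊢
  rcases hb with ⟨rfl, hl⟩ | hjs
  · omega
  · have h1 : (i : ℕ) < D.rmax + 1 :=
      Nat.lt_succ_of_le (i.2.le.trans (Finset.le_sup (f := D.r) (Finset.mem_univ s)))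
    have h2 : D.p - s + 1 ≤ D.p - j := by
      have := s.2
      have : (j : ℕ) < s := hjs
      omega
    calc (D.p - s) * (D.rmax + 1) + i < (D.p - s + 1) * (D.rmax + 1) := by rw [add_mul]; omega
      _ ≤ (D.p - j) * (D.rmax + 1) := Nat.mul_le_mul_right _ h2
      _ ≤ _ := Nat.le_add_right _ _

variable {g : Fin m → ℝ → ℝ} {h : Fin D.p → ℝ → ℝ} {d k : ℕ}

theorem exists_bound_augDiff (hg : ∀ q, BD d (g q)) (hh : ∀ j, DivPow (g (D.inp j)) k d (h j))
    (hrd : ∀ j, D.r j ≤ d + 1) (hrk : ∀ j, D.r j ≤ k) :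
    ∃ K : ℝ, 0 ≤ K ∧ ∀ t ∈ Ici (0 : ℝ), ∀ a b, |D.augDiff h t a b| ≤ K := by
  have hb : ∀ a b : D.Idx, ∃ C : ℝ, ∀ t ∈ Ici (0 : ℝ), |D.augDiff h t a b| ≤ C := fun a b =>
    (((divPow_augCoeff hg hh a.1 (hrd _) (hrk _) a.2 a.2.2.le b).mono (hg _).zero_of
      (Nat.zero_le _) (Nat.zero_le _)).bd (hg _).zero_of).bdd
  choose C hC using hb
  refine ⟨∑ a, ∑ b, |C a b|, by positivity, fun t ht a b => (hC a b t ht).trans ?_⟩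
  refine (le_abs_self _).trans ((Finset.single_le_sum (f := fun b => |C a b|)
    (fun _ _ => abs_nonneg _) (Finset.mem_univ b)).trans ?_)
  exact Finset.single_le_sum (f := fun a => ∑ b, |C a b|)
    (fun _ _ => Finset.sum_nonneg fun _ _ => abs_nonneg _) (Finset.mem_univ a)

theorem exists_linear_ode_solution_augMatrix (hh : ∀ j, BD d (h j)) {t₀ : ℝ} (ht₀ : 0 ≤ t₀)
    (y₀ : D.Idx → ℝ) :
    ∃ y : ℝ → D.Idx → ℝ, y t₀ = y₀ ∧ ∀ t ∈ Ici t₀,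
      HasDerivWithinAt y (D.augMatrix h t *ᵥ y t) (Ici t₀) t := by
  have hbd := bd_augMatrix hh
  choose C hC using fun a b => (hbd a b).bdd
  let E : D.Idx → D.Idx → (D.Idx → ℝ) →L[ℝ] (D.Idx → ℝ) := fun a b =>
    (ContinuousLinearMap.proj (R := ℝ) (φ := fun _ : D.Idx => ℝ) b).smulRight (Pi.single a 1)
  -- The coefficients are controlled only on `[0,∞)`; `max t 0` extends them to a bounded continuous
  -- family on the line.
  let F : ℝ → (D.Idx → ℝ) →L[ℝ] (D.Idx → ℝ) := fun t =>
    ∑ a, ∑ b, D.augMatrix h (max t 0) a b • E a b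
  have hF : Continuous F := by
    have hm : Continuous fun t : ℝ => max t 0 := by fun_prop
    refine continuous_finsetSum _ fun a _ => continuous_finsetSum _ fun b _ => ?_
    have h1 : Continuous fun t : ℝ => D.augMatrix h (max t 0) a b :=
      (hbd a b).continuousOn.comp_continuous hm fun s => mem_Ici.2 (le_max_right _ _)
    exact h1.smul continuous_const
  have hK : ∀ t, ‖F t‖ ≤ ∑ a, ∑ b, |C a b| * ‖E a b‖ := fun t => by
    refine (norm_sum_le _ _).trans (Finset.sum_le_sum fun a _ => ?_)
    refine (norm_sum_le _ _).trans (Finset.sum_le_sum fun b _ => ?_)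
    rw [norm_smul]
    exact mul_le_mul_of_nonneg_right
      ((hC a b _ (mem_Ici.2 (le_max_right _ _))).trans (le_abs_self _)) (norm_nonneg _)
  obtain ⟨y, hy0, hy⟩ := exists_linear_ode_solution F hF (by positivity) hK t₀ y₀
  refine ⟨y, hy0, fun t ht => (hy t ht).congr_deriv ?_⟩
  ext a
  simp only [F, max_eq_left (ht₀.trans ht), E]
  simp [Finset.sum_apply, Pi.single_apply, Matrix.mulVec, dotProduct]

/-- The construction runs backwards: the linear equation is solved for the augmented states, `z` is
recovered as `Ω - P Ω`, and the control is read off from the feedback law. -/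
theorem exists_closedLoop {n : ℕ} {A : Matrix (Fin n) (Fin n) ℝ} {B : Matrix (Fin n) (Fin m) ℝ}
    {T : Matrix D.Idx (Fin n) ℝ} {R : Fin D.p → ℝ → ℝ} (hT : D.IsCanonicalForm A B T)
    (hg : ∀ q, BD d (g q)) (hh : ∀ j, DivPow (g (D.inp j)) k d (D.damping g R j))
    (hrd : ∀ j, D.r j ≤ d + 1) (hrk : ∀ j, D.r j ≤ k) {t₀ : ℝ} (ht₀ : 0 ≤ t₀)
    (x₀ : Fin n → ℝ) :
    ∃ (x : ℝ → Fin n → ℝ) (u : ℝ → Fin m → ℝ) (Ω : (j : Fin D.p) → Fin (D.r j) → ℝ → ℝ),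
      D.ClosedLoop A B T g R t₀ x u Ω ∧ x t₀ = x₀ ∧ ContinuousOn u (Ici t₀) := by
  obtain ⟨⟨S, hTS, hST, -⟩, -⟩ := id hT
  set h := D.damping g R with hdef
  have hsub : ∀ {t}, t ∈ Ici t₀ → t ∈ Ici (0 : ℝ) := fun ht => mem_Ici.2 (ht₀.trans ht)
  obtain ⟨K, hK, hPb⟩ := exists_bound_augDiff hg hh hrd hrk
  obtain ⟨C, hC, hinv⟩ := exists_bound_unipotent D.height hK
  -- The bound for unipotent matrices makes `1 - P(t₀)` injective, hence surjective, so the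
  -- prescribed initial state is reached.
  obtain ⟨y₀, hy₀⟩ : ∃ y₀, ((1 : Matrix D.Idx D.Idx ℝ) - D.augDiff h t₀).mulVecLin y₀ = T *ᵥ x₀ := by
    refine LinearMap.injective_iff_surjective.1 ((injective_iff_map_eq_zero _).2 fun v hv => ?_) _
    have := hinv _ (hPb t₀ ht₀) (height_lt_of_augDiff_ne_zero h ht₀) v 0 (fun a => by
      simpa [Matrix.sub_mulVec] using congrFun hv a)
    ext a
    simpa using this a
  rw [Matrix.mulVecLin_apply, Matrix.sub_mulVec, Matrix.one_mulVec] at hy₀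
  obtain ⟨y, hyt₀, hy⟩ := exists_linear_ode_solution_augMatrix (D := D) (d := 0) (h := h)
    (fun j => ((hh j).bd (hg _)).zero_of) ht₀ y₀
  have hya : ∀ t ∈ Ici t₀, ∀ a, HasDerivWithinAt (fun t => y t a) ((D.augMatrix h t *ᵥ y t) a)
    (Ici t₀) t := fun t ht => hasDerivWithinAt_pi.1 (hy t ht)
  have hycont : ∀ a, ContinuousOn (fun t => y t a) (Ici t₀) :=
    fun a t ht => (hya t ht a).continuousWithinAt
  -- the coefficients are divisible by `g`, which makes the control continuous
  have hquot : ∀ (j : Fin D.p) (i : ℕ), ∃ w : D.Idx → ℝ → ℝ, i ≤ D.r j →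
      ∀ b, ContinuousOn (w b) (Ici 0) ∧
        ∀ t ∈ Ici (0 : ℝ), D.augCoeff h j i b t = g (D.inp j) t * w b t := by
    intro j i
    by_cases hi : i ≤ D.r j
    · have h1 : ∀ b, DivPow (g (D.inp j)) 1 0 (D.augCoeff h j i b) := fun b =>
        (divPow_augCoeff hg hh j (hrd j) (hrk j) i hi b).mono (hg _).zero_of
          (by have := hrk j; omega) (Nat.zero_le _)
      choose w hw hw' using h1
      exact ⟨w, fun _ b => ⟨(hw b).continuousOn, fun t ht => by simpa using hw' b t ht⟩⟩
    · exact ⟨fun _ _ => 0, fun hi' => absurd hi' hi⟩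
  choose w hw using hquot
  let z : ℝ → D.Idx → ℝ := fun t a => y t a - ∑ b, D.augCoeff h a.1 a.2 b t * y t b
  -- In the feedback law `d/dt (Ω_{r_j} - z_{r_j}) + h_j Ω_{r_j}` is the linear form of stage `D.r
  -- j`. Replacing all coefficients by their quotients `w` carries out the division by `g_j`.
  let v : Fin D.p → ℝ → ℝ := fun j t =>
    - ∑ i : Fin (D.r j), D.α j i.rev * ∑ b, w j i b t * y t b - ∑ b, w j (D.r j) b t * y t b
  let u : ℝ → Fin m → ℝ := fun t => Function.extend D.inp (fun j => v j t) 0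
  have hu : ∀ t j, u t (D.inp j) = v j t := fun t j => D.inp.injective.extend_apply _ _ _
  have hu0 : ∀ q, (∀ j, q ≠ D.inp j) → ∀ t, u t q = 0 := fun q hq t =>
    Function.extend_apply' _ _ _ (by rintro ⟨j, hj⟩; exact hq j hj.symm)
  have hTz : ∀ t, T *ᵥ (S *ᵥ z t) = z t := fun t => by
    rw [Matrix.mulVec_mulVec, hTS, Matrix.one_mulVec]
  have hgv : ∀ j, ∀ t ∈ Ici t₀, g (D.inp j) t * v j t =
      - ∑ i : Fin (D.r j), D.α j i.rev * (y t ⟨j, i⟩ - z t ⟨j, i⟩)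
        - ∑ b, D.augCoeff h j (D.r j) b t * y t b := by
    intro j t ht
    have e : ∀ i ≤ D.r j, ∑ b, D.augCoeff h j i b t * y t b =
        g (D.inp j) t * ∑ b, w j i b t * y t b := fun i hi => by
      rw [Finset.mul_sum]
      exact Finset.sum_congr rfl fun b _ => by rw [((hw j i hi b).2 t (hsub ht)), mul_assoc]
    rw [e _ le_rfl]
    simp only [v, z, sub_sub_cancel]
    have e' : ∀ i : Fin (D.r j), D.α j i.rev * ∑ b, D.augCoeff h j i b t * y t b =
        g (D.inp j) t * (D.α j i.rev * ∑ b, w j i b t * y t b) := fun i => by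
      rw [e i i.2.le]
      ring
    rw [Finset.sum_congr rfl fun i _ => e' i, ← Finset.mul_sum]
    ring
  have hPd : ∀ (j : Fin D.p) (i : Fin (D.r j)), ∀ t ∈ Ici t₀,
      HasDerivWithinAt (fun t => y t ⟨j, i⟩ - z t ⟨j, i⟩)
        (∑ b, D.augCoeff h j (i + 1) b t * y t b - h j t * y t ⟨j, i⟩) (Ici t₀) t := by
    intro j i t ht
    simp only [z, sub_sub_cancel]
    exact hasDerivWithinAt_sum_augCoeff hg hh j (hrd j) (hrk j) i ht₀
      (y := fun b t => y t b) ht (hya t ht)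
  have hz0 : ∀ j t, z t ⟨j, D.fst j⟩ = y t ⟨j, D.fst j⟩ := fun j t => by
    simp [z, fst, augCoeff]
  have hzd : ∀ t ∈ Ici t₀, HasDerivWithinAt z (T *ᵥ (A *ᵥ (S *ᵥ z t) +
      (B * Matrix.diagonal fun q => g q t) *ᵥ u t)) (Ici t₀) t := by
    intro t ht
    rw [hasDerivWithinAt_pi]
    rintro ⟨j, l⟩
    have hd := ((hya t ht ⟨j, l⟩).sub (hPd j l t ht)).congr (f₁ := fun t => z t ⟨j, l⟩)
      (fun s _ => by simp) (by simp)
    refine hd.congr_deriv ?_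
    rw [Matrix.mulVec_add, Pi.add_apply, hT.input_apply _ _ fun q hq => hu0 q hq t,
      Matrix.mulVec_mulVec, hT.mul_comm, ← Matrix.mulVec_mulVec, hTz, augMatrix_mulVec]
    rcases exists_succ_or_eq_lst j l with ⟨l', hl⟩ | rfl
    · rw [Ahat_mulVec_of_lt _ j hl, Ahat_mulVec_of_lt _ j hl, if_neg]
      · simp only [hz0]
        simp only [z, hl]
        ring
      · rintro rfl
        have := l'.2
        simp only [lst] at hl
        omega
    · have e : ((D.lst j : ℕ)) + 1 = D.r j := Nat.sub_add_cancel (D.r_pos j)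
      rw [Ahat_mulVec_lst, Ahat_mulVec_lst, if_pos rfl, hu, hgv j t ht, e]
      simp only [hz0, mul_sub, Finset.sum_sub_distrib]
      ring
  refine ⟨fun t => S *ᵥ z t, u, fun j i t => y t ⟨j, i⟩, ⟨?_, ?_, ?_, ?_, ?_, ?_⟩, ?_, ?_⟩
  · intro t ht
    have h1 := hasDerivWithinAt_pi.1 (hzd t ht)
    refine hasDerivWithinAt_pi.2 fun q => ?_
    refine (HasDerivWithinAt.fun_sum (u := Finset.univ) fun a _ =>
      (h1 a).const_mul (S q a)).congr_deriv ?_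
    have h2 : ∀ f : Fin n → ℝ, S *ᵥ (T *ᵥ f) = f := fun f => by
      rw [Matrix.mulVec_mulVec, hST, Matrix.one_mulVec]
    exact congrFun (h2 _) q
  · exact fun j i t ht => (hya t ht ⟨j, i⟩).differentiableWithinAt
  · intro j t ht
    rw [hTz, hz0]
  · intro j i i' hi t ht
    rw [(hya t ht ⟨j, i⟩).derivWithin (uniqueDiffOn_Ici t₀ t ht), augMatrix_mulVec,
      Ahat_mulVec_of_lt _ j hi]
    simp only [hdef, damping]
    ring
  · intro j t ht
    simp only [hTz]
    rw [(hPd j (D.lst j) t ht).derivWithin (uniqueDiffOn_Ici t₀ t ht), hu, hgv j t ht,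
      show ((D.lst j : ℕ)) + 1 = D.r j from Nat.sub_add_cancel (D.r_pos j)]
    simp only [hdef, damping]
    ring
  · exact fun q hq t _ => hu0 q hq t
  · have : z t₀ = T *ᵥ x₀ := by
      rw [← hy₀, ← hyt₀]
      rfl
    simp only [this, Matrix.mulVec_mulVec, hST, Matrix.one_mulVec]
  · refine continuousOn_pi.2 fun q => ?_
    by_cases hq : ∃ j, q = D.inp j
    · obtain ⟨j, rfl⟩ := hq
      simp only [hu]
      have hterm : ∀ i ≤ D.r j, ContinuousOn (fun t => ∑ b, w j i b t * y t b) (Ici t₀) :=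
        fun i hi => continuousOn_finsetSum _ fun b _ =>
          ((hw j i hi b).1.mono fun _ => hsub).mul (hycont b)
      exact (continuousOn_finsetSum _ fun (i : Fin (D.r j)) _ =>
        continuousOn_const.mul (hterm i i.2.le)).neg.sub (hterm _ le_rfl)
    · push Not at hq
      simp only [hu0 q hq]
      exact continuousOn_const

end BlockData

/-! ### Lyapunov estimate for the augmented states. -/

/-- The quadratic form of a companion matrix. -/
theorem companion_form_le {r : ℕ} (hr : 0 < r) (α : Fin r → ℝ) (M : Matrix (Fin r) (Fin r) ℝ)
    (hM : ∀ l i : Fin r, M l i = if (l : ℕ) + 1 = r then - α i.rev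
      else if (i : ℕ) = (l : ℕ) + 1 then 1 else 0) {L : ℝ}
    (h1 : 1 + |α ⟨r - 1, by omega⟩| ≤ L)
    (h2 : ∀ l : Fin r, 0 < (l : ℕ) → (l : ℕ) + 1 < r → 2 + |α l.rev| ≤ L)
    (h3 : 1 - 2 * α ⟨0, hr⟩ +
      ∑ i ∈ Finset.univ.filter (fun i : Fin r => (i : ℕ) + 1 < r), |α i.rev| ≤ L)
    (w : Fin r → ℝ) :
    2 * ∑ l, w l * ∑ i, M l i * w i ≤ L * ∑ i, w i ^ 2 := by
  obtain ⟨e, rfl⟩ : ∃ e, r = e + 1 := ⟨r - 1, by omega⟩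
  have hlast : ∑ i, M (Fin.last e) i * w i = - ∑ i, α i.rev * w i := by
    rw [← Finset.sum_neg_distrib]
    exact Finset.sum_congr rfl fun i _ => by rw [hM, if_pos (by simp)]; ring
  have hcast : ∀ l : Fin e, ∑ i, M l.castSucc i * w i = w l.succ := fun l => by
    rw [Finset.sum_eq_single l.succ]
    · rw [hM, if_neg (by have := l.2; simp; omega), if_pos (by simp), one_mul]
    · intro i _ hi
      rw [hM, if_neg (by have := l.2; simp; omega), if_neg, zero_mul]
      exact fun h => hi (Fin.ext (by simpa using h))
    · simp
  have hS : ∑ i ∈ Finset.univ.filter (fun i : Fin (e + 1) => (i : ℕ) + 1 < e + 1), |α i.rev| =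
      ∑ i : Fin e, |α i.castSucc.rev| := by
    rw [Finset.sum_filter, Fin.sum_univ_castSucc]
    simp
  rw [hS] at h3
  rw [Fin.sum_univ_castSucc (f := fun l => w l * ∑ i, M l i * w i), hlast]
  simp only [hcast]
  rw [Fin.sum_univ_castSucc (f := fun i => α i.rev * w i), Fin.rev_last]
  have hα0 : α ⟨0, hr⟩ = α 0 := rfl
  rw [hα0] at h3
  -- bounds for the products of neighbours and for the products with the last entry
  have ha : 2 * ∑ l : Fin e, w l.castSucc * w l.succ ≤
      ∑ l : Fin e, w l.castSucc ^ 2 + ∑ l : Fin e, w l.succ ^ 2 := by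
    rw [Finset.mul_sum, ← Finset.sum_add_distrib]
    exact Finset.sum_le_sum fun l _ => by nlinarith [sq_nonneg (w l.castSucc - w l.succ)]
  have hb : -(2 * (w (Fin.last e) * ∑ i : Fin e, α i.castSucc.rev * w i.castSucc)) ≤
      ∑ i : Fin e, |α i.castSucc.rev| * w i.castSucc ^ 2 +
        (∑ i : Fin e, |α i.castSucc.rev|) * w (Fin.last e) ^ 2 := by
    rw [Finset.sum_mul, ← Finset.sum_add_distrib, Finset.mul_sum, Finset.mul_sum,
      ← Finset.sum_neg_distrib]
    refine Finset.sum_le_sum fun i _ => ?_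
    rcases abs_cases (α i.castSucc.rev) with ⟨h, h'⟩ | ⟨h, h'⟩ <;> rw [h]
    · nlinarith [mul_nonneg h' (sq_nonneg (w i.castSucc + w (Fin.last e)))]
    · nlinarith [mul_nonneg (neg_nonneg.2 h'.le) (sq_nonneg (w i.castSucc - w (Fin.last e)))]
  -- For size at least 2, the first square comes from one neighbour product, a middle one from two,
  -- the last from one neighbour product and the whole last row: hence the three kinds of terms in
  -- `lamStar`.
  have hc : ∑ l : Fin e, w l.castSucc ^ 2 + ∑ l : Fin e, w l.succ ^ 2 +
      ∑ i : Fin e, |α i.castSucc.rev| * w i.castSucc ^ 2 +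
        ((∑ i : Fin e, |α i.castSucc.rev|) - 2 * α 0) * w (Fin.last e) ^ 2 ≤
      L * ∑ i, w i ^ 2 := by
    cases e with
    | zero =>
      simp only [Finset.univ_eq_empty, Finset.sum_empty] at h3 ⊢
      have : ∑ i : Fin (0 + 1), w i ^ 2 = w (Fin.last 0) ^ 2 := Fin.sum_univ_one _
      rw [this]
      nlinarith [sq_nonneg (w (Fin.last 0))]
    | succ e =>
      have hfirst : (1 + |α (Fin.last (e + 1))|) * w 0 ^ 2 ≤ L * w 0 ^ 2 :=
        mul_le_mul_of_nonneg_right h1 (sq_nonneg _)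
      have hmid : ∑ i : Fin e, (2 + |α i.succ.castSucc.rev|) * w i.succ.castSucc ^ 2 ≤
          ∑ i : Fin e, L * w i.succ.castSucc ^ 2 :=
        Finset.sum_le_sum fun i _ => mul_le_mul_of_nonneg_right
          (h2 _ (by simp) (by simp)) (sq_nonneg _)
      have hend := mul_le_mul_of_nonneg_right h3 (sq_nonneg (w (Fin.last (e + 1))))
      rw [Fin.sum_univ_castSucc (f := fun i => w i ^ 2),
        Fin.sum_univ_succ (f := fun i : Fin (e + 1) => w i.castSucc ^ 2),
        Fin.sum_univ_castSucc (f := fun i : Fin (e + 1) => w i.succ ^ 2),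
        Fin.sum_univ_succ (f := fun i : Fin (e + 1) => |α i.castSucc.rev| * w i.castSucc ^ 2)]
      simp only [← Finset.mul_sum, add_mul, Finset.sum_add_distrib, Fin.castSucc_zero,
        Fin.rev_zero, Fin.succ_last, ← Fin.succ_castSucc] at hmid hfirst hend ⊢
      nlinarith
  nlinarith

/-- The bilinear form of a matrix is bounded by its spectral norm. -/
theorem two_mul_bilin_le {r s : ℕ} (M : Matrix (Fin r) (Fin s) ℝ) (w : Fin r → ℝ)
    (v : Fin s → ℝ) :
    2 * ∑ l, w l * ∑ i, M l i * v i ≤ ‖M‖ * (∑ l, w l ^ 2 + ∑ i, v i ^ 2) := by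
  have h1 : ∑ l, w l * ∑ i, M l i * v i =
      inner ℝ (WithLp.toLp 2 w) (WithLp.toLp 2 (M *ᵥ v)) := by
    simp [PiLp.inner_apply, Matrix.mulVec, dotProduct, mul_comm]
  have h2 := Matrix.l2_opNorm_mulVec M (WithLp.toLp 2 v)
  have h3 := real_inner_le_norm (WithLp.toLp 2 w) (WithLp.toLp 2 (M *ᵥ v))
  have h4 : ∀ {r : ℕ} (w : Fin r → ℝ), ∑ l, w l ^ 2 = ‖WithLp.toLp 2 w‖ ^ 2 := fun w => by
    simp [EuclideanSpace.norm_sq_eq]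
  rw [h1, h4, h4]
  have h5 : ‖WithLp.toLp 2 (M *ᵥ v)‖ ≤ ‖M‖ * ‖WithLp.toLp 2 v‖ := h2
  have h6 := mul_le_mul_of_nonneg_left h5 (norm_nonneg (WithLp.toLp 2 w))
  nlinarith [norm_nonneg M, mul_nonneg (norm_nonneg M)
    (sq_nonneg (‖WithLp.toLp 2 w‖ - ‖WithLp.toLp 2 v‖))]

namespace BlockData

variable {m : ℕ} (D : BlockData m)

theorem block_form_le (j : Fin D.p) (w : Fin (D.r j) → ℝ) :
    2 * ∑ l, w l * ∑ i, D.block j j l i * w i ≤ D.lamStar j * ∑ i, w i ^ 2 := by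
  refine companion_form_le (D.r_pos j) (D.α j) _ (fun l i => by simp [block]) ?_ ?_ ?_ w
  · exact Finset.le_max' _ _ (Finset.mem_insert_self _ _)
  · intro l hl hl'
    refine Finset.le_max' _ _ (Finset.mem_insert_of_mem (Finset.mem_insert_of_mem ?_))
    exact Finset.mem_image.2 ⟨l, by simp [hl, hl'], rfl⟩
  · exact Finset.le_max' _ _ (Finset.mem_insert_of_mem (Finset.mem_insert_self _ _))

theorem Ahat_form_le (v : D.Idx → ℝ) (j : Fin D.p) :
    2 * ∑ l, v ⟨j, l⟩ * (D.Ahat *ᵥ v) ⟨j, l⟩ ≤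
      (D.lamStar j + D.rowSum j) * ∑ i, v ⟨j, i⟩ ^ 2
        + ∑ s ∈ Finset.Ioi j, ‖D.block j s‖ * ∑ i, v ⟨s, i⟩ ^ 2 := by
  have h1 := D.block_form_le j fun i => v ⟨j, i⟩
  have h2 := Finset.sum_le_sum fun s (_ : s ∈ Finset.Ioi j) =>
    two_mul_bilin_le (D.block j s) (fun i => v ⟨j, i⟩) fun i => v ⟨s, i⟩
  simp only [Ahat_mulVec, mul_add, Finset.sum_add_distrib] at h2 ⊢
  have h3 : ∑ l, v ⟨j, l⟩ * ∑ s ∈ Finset.Ioi j, ∑ i, D.block j s l i * v ⟨s, i⟩ =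
      ∑ s ∈ Finset.Ioi j, ∑ l, v ⟨j, l⟩ * ∑ i, D.block j s l i * v ⟨s, i⟩ := by
    rw [Finset.sum_comm]
    simp only [Finset.mul_sum]
  rw [h3, rowSum, add_mul, Finset.sum_mul]
  rw [← Finset.mul_sum] at h2
  linarith

section Sigma

variable {D} {lam : Fin D.p → ℝ}

theorem rowSum_nonneg (j : Fin D.p) : 0 ≤ D.rowSum j := Finset.sum_nonneg fun _ _ => norm_nonneg _

theorem colSum_nonneg (j : Fin D.p) : 0 ≤ D.colSum j := Finset.sum_nonneg fun _ _ => norm_nonneg _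

theorem lt_sigma_iff (x : ℝ) : x < D.sigma lam ↔ x < D.gam lam D.lstBlock / 2 ∧
    x < D.gam lam D.fstBlock - D.rowSum D.fstBlock ∧
      ∀ j ∈ D.midBlocks, x < (D.gam lam j - D.rowSum j) / 2 := by
  simp [sigma, Finset.lt_min'_iff]

theorem sigma_pos (h : D.CouplingIneq lam) : 0 < D.sigma lam := by
  obtain ⟨h1, h2, h3⟩ := h
  refine (lt_sigma_iff 0).2 ⟨?_, by linarith, fun j hj => ?_⟩
  · linarith [colSum_nonneg D.lstBlock]
  · linarith [h2 j hj, colSum_nonneg j]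

theorem sigma_le_of_fst : D.sigma lam ≤ D.gam lam D.fstBlock - D.rowSum D.fstBlock :=
  Finset.min'_le _ _ (by simp)

/-- Every block after the first has margin `2 σ`: one `σ` is the decay rate, the other pays for
cross terms with earlier blocks. -/
theorem two_mul_sigma_le {j : Fin D.p} (hj : 0 < (j : ℕ)) :
    2 * D.sigma lam ≤ D.gam lam j - D.rowSum j := by
  by_cases hm : (j : ℕ) + 1 < D.p
  · have : D.sigma lam ≤ (D.gam lam j - D.rowSum j) / 2 := by
      refine Finset.min'_le _ _ (Finset.mem_insert_of_mem (Finset.mem_insert_of_mem ?_))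
      exact Finset.mem_image.2 ⟨j, by simp [midBlocks, hj, hm], rfl⟩
    linarith
  · have hl : j = D.lstBlock := Fin.ext (by have := j.2; simp only [lstBlock]; omega)
    have h0 : D.rowSum j = 0 := by
      refine Finset.sum_eq_zero fun s hs => absurd (Finset.mem_Ioi.1 hs) ?_
      rw [Fin.lt_def]
      have := s.2
      omega
    have : D.sigma lam ≤ D.gam lam D.lstBlock / 2 := Finset.min'_le _ _ (by simp)
    rw [h0, hl]
    linarith

/-- The thresholds and the coupling norms do not depend on the gains, so large gains meet all
requirements. -/
theorem exists_gains (D : BlockData m) (ρ : ℝ) : ∃ lam : Fin D.p → ℝ, (∀ j, 0 < lam j) ∧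
    D.CouplingIneq lam ∧ ρ ≤ D.sigma lam / 2 := by
  have hb : ∀ j, 0 ≤ |D.lamStar j| := fun j => abs_nonneg _
  let lam : Fin D.p → ℝ := fun j =>
    |D.lamStar j| + D.rowSum j + 2 * D.colSum j + 4 * |ρ| + 1
  have hgam : ∀ j, D.rowSum j + 2 * D.colSum j + 4 * |ρ| + 1 ≤ D.gam lam j := fun j => by
    simp only [gam, lam]
    linarith [le_abs_self (D.lamStar j)]
  refine ⟨lam, fun j => ?_, ⟨?_, fun j _ => ?_, ?_⟩, ?_⟩
  · have := rowSum_nonneg j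
    have := colSum_nonneg j
    positivity
  · linarith [hgam D.fstBlock, colSum_nonneg D.fstBlock, abs_nonneg ρ]
  · linarith [hgam j, abs_nonneg ρ]
  · linarith [hgam D.lstBlock, colSum_nonneg D.lstBlock, rowSum_nonneg D.lstBlock, abs_nonneg ρ]
  · have h : 2 * |ρ| < D.sigma lam := by
      refine (lt_sigma_iff _).2 ⟨?_, ?_, fun j _ => ?_⟩
      · linarith [hgam D.lstBlock, colSum_nonneg D.lstBlock, rowSum_nonneg D.lstBlock]
      · linarith [hgam D.fstBlock, colSum_nonneg D.fstBlock, abs_nonneg ρ]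
      · linarith [hgam j, colSum_nonneg j]
    linarith [le_abs_self ρ]

end Sigma

variable {D} {lam : Fin D.p → ℝ}

/-- Dissipation inequality for the weighted sum of the block energies. -/
theorem dissipation_le {c C N : ℝ} (hσ : 0 < D.sigma lam) (hc : 0 < c) (hN1 : 1 ≤ N)
    (hN : ∀ s, C * D.colSum s ≤ N * (D.sigma lam * c)) (ρ : Fin D.p → ℝ)
    (hρ : ∀ j, c ≤ ρ j ∧ ρ j ≤ C) (v : D.Idx → ℝ) :
    ∑ j : Fin D.p, N ^ (j : ℕ) * (ρ j * (-lam j * ∑ i, v ⟨j, i⟩ ^ 2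
        + 2 * ∑ l, v ⟨j, l⟩ * (D.Ahat *ᵥ v) ⟨j, l⟩)) ≤
      -D.sigma lam * ∑ j : Fin D.p, N ^ (j : ℕ) * (ρ j * ∑ i, v ⟨j, i⟩ ^ 2) := by
  set q : Fin D.p → ℝ := fun j => ∑ i, v ⟨j, i⟩ ^ 2 with hq
  have hq0 : ∀ j, 0 ≤ q j := fun j => Finset.sum_nonneg fun _ _ => sq_nonneg _
  have hNp : ∀ k : ℕ, 0 < N ^ k := fun k => pow_pos (one_pos.trans_le hN1) k
  have hρ0 : ∀ j, 0 < ρ j := fun j => hc.trans_le (hρ j).1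
  -- Cross terms are regrouped by the block whose energy they contain, where they will be absorbed.
  have hswap : ∑ j : Fin D.p, N ^ (j : ℕ) * (ρ j * ∑ s ∈ Finset.Ioi j, ‖D.block j s‖ * q s) =
      ∑ s : Fin D.p, (∑ j ∈ Finset.Iio s, N ^ (j : ℕ) * ρ j * ‖D.block j s‖) * q s := by
    simp only [Finset.mul_sum, Finset.sum_mul]
    rw [Finset.sum_comm' (t' := Finset.univ) (s' := fun s => Finset.Iio s) (by simp)]
    exact Finset.sum_congr rfl fun _ _ => Finset.sum_congr rfl fun _ _ => by ring
  calc _ ≤ ∑ j : Fin D.p, (N ^ (j : ℕ) * (ρ j * ((-D.gam lam j + D.rowSum j) * q j))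
          + N ^ (j : ℕ) * (ρ j * ∑ s ∈ Finset.Ioi j, ‖D.block j s‖ * q s)) := by
        refine Finset.sum_le_sum fun j _ => ?_
        rw [← mul_add, ← mul_add]
        refine mul_le_mul_of_nonneg_left (mul_le_mul_of_nonneg_left ?_ (hρ0 j).le) (hNp _).le
        have := D.Ahat_form_le v j
        simp only [gam]
        linarith
    _ = ∑ j : Fin D.p, (N ^ (j : ℕ) * (ρ j * ((-D.gam lam j + D.rowSum j) * q j))
          + (∑ k ∈ Finset.Iio j, N ^ (k : ℕ) * ρ k * ‖D.block k j‖) * q j) := by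
        rw [Finset.sum_add_distrib, hswap, ← Finset.sum_add_distrib]
    _ ≤ ∑ j : Fin D.p, -D.sigma lam * (N ^ (j : ℕ) * (ρ j * q j)) := by
        refine Finset.sum_le_sum fun j _ => ?_
        have hpos : 0 ≤ N ^ (j : ℕ) * (ρ j * q j) :=
          mul_nonneg (hNp _).le (mul_nonneg (hρ0 j).le (hq0 j))
        rcases Nat.eq_zero_or_pos (j : ℕ) with h0 | h0
        · have hj : j = D.fstBlock := Fin.ext h0
          have he : Finset.Iio j = ∅ := by
            refine Finset.eq_empty_of_forall_notMem fun s hs => ?_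
            have := Fin.lt_def.1 (Finset.mem_Iio.1 hs)
            omega
          rw [he, Finset.sum_empty, zero_mul, add_zero]
          have := sigma_le_of_fst (D := D) (lam := lam)
          rw [← hj] at this
          nlinarith
        · have h2 := two_mul_sigma_le (lam := lam) h0
          -- Earlier blocks have weight at most `N ^ (j - 1)`, and by the choice of `N` the missing
          -- factor `N` outweighs `C * D.colSum j`.
          have hsum : ∑ k ∈ Finset.Iio j, N ^ (k : ℕ) * ρ k * ‖D.block k j‖ ≤
              N ^ (j : ℕ) * (D.sigma lam * ρ j) := by
            calc _ ≤ ∑ k ∈ Finset.Iio j, N ^ ((j : ℕ) - 1) * C * ‖D.block k j‖ := by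
                  refine Finset.sum_le_sum fun k hk => ?_
                  have hkj := Fin.lt_def.1 (Finset.mem_Iio.1 hk)
                  refine mul_le_mul_of_nonneg_right ?_ (norm_nonneg _)
                  exact mul_le_mul (pow_le_pow_right₀ hN1 (by omega)) (hρ k).2 (hρ0 k).le
                    (hNp _).le
              _ = N ^ ((j : ℕ) - 1) * (C * D.colSum j) := by
                  rw [← Finset.mul_sum, colSum, mul_assoc]
              _ ≤ N ^ ((j : ℕ) - 1) * (N * (D.sigma lam * c)) :=
                  mul_le_mul_of_nonneg_left (hN j) (hNp _).le
              _ = N ^ (j : ℕ) * (D.sigma lam * c) := by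
                  rw [← mul_assoc, ← pow_succ, Nat.sub_add_cancel h0]
              _ ≤ _ := by
                  refine mul_le_mul_of_nonneg_left ?_ (hNp _).le
                  exact mul_le_mul_of_nonneg_left (hρ j).1 hσ.le
          have h3 := mul_le_mul_of_nonneg_right hsum (hq0 j)
          nlinarith
    _ = _ := by rw [← Finset.mul_sum]

theorem augmented_decay {g : Fin m → ℝ → ℝ} {R : Fin D.p → ℝ → ℝ}
    (hR : D.IsPersistenceFilter g lam R) (hσ : 0 < D.sigma lam) {c C : ℝ} (hc : 0 < c)
    (hb : ∀ j, ∀ t ∈ Ici (0 : ℝ), c ≤ R j t ∧ R j t ≤ C) :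
    ∃ M : ℝ, 0 < M ∧ ∀ t₀ : ℝ, 0 ≤ t₀ → ∀ y : D.Idx → ℝ → ℝ,
      (∀ t ∈ Ici t₀, ∀ a, HasDerivWithinAt (y a)
        ((D.augMatrix (D.damping g R) t *ᵥ fun b => y b t) a) (Ici t₀) t) →
      ∀ t, t₀ ≤ t →
        ∑ a, y a t ^ 2 ≤ M * Real.exp (-D.sigma lam * (t - t₀)) * ∑ a, y a t₀ ^ 2 := by
  have hcC : c ≤ C := by
    have := hb D.fstBlock 0 (mem_Ici.2 le_rfl)
    exact this.1.trans this.2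
  have hC : 0 < C := hc.trans_le hcC
  set N : ℝ := 1 + ∑ s, C * D.colSum s / (D.sigma lam * c) with hNdef
  have hN0 : ∀ s, 0 ≤ C * D.colSum s / (D.sigma lam * c) := fun s =>
    div_nonneg (mul_nonneg hC.le (colSum_nonneg s)) (mul_pos hσ hc).le
  have hN1 : 1 ≤ N := le_add_of_nonneg_right (Finset.sum_nonneg fun s _ => hN0 s)
  have hNp : ∀ k : ℕ, 0 < N ^ k := fun k => pow_pos (one_pos.trans_le hN1) k
  have hN : ∀ s, C * D.colSum s ≤ N * (D.sigma lam * c) := fun s => by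
    rw [← div_le_iff₀ (mul_pos hσ hc)]
    have := Finset.single_le_sum (fun s _ => hN0 s) (Finset.mem_univ s)
    linarith
  -- This is the ratio of the upper and lower constants comparing the weighted energy `W` with `∑ y
  -- ^ 2`.
  refine ⟨N ^ D.p * C / c, by have := hNp D.p; positivity, fun t₀ ht₀ y hy t ht => ?_⟩
  have hsub : ∀ {t}, t ∈ Ici t₀ → t ∈ Ici (0 : ℝ) := fun h => mem_Ici.2 (ht₀.trans h)
  let W : ℝ → ℝ := fun t => ∑ j : Fin D.p, N ^ (j : ℕ) * (R j t * ∑ i, y ⟨j, i⟩ t ^ 2)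
  let W' : ℝ → ℝ := fun t => ∑ j : Fin D.p, N ^ (j : ℕ) * (R j t *
    (-lam j * ∑ i, y ⟨j, i⟩ t ^ 2
      + 2 * ∑ l, y ⟨j, l⟩ t * (D.Ahat *ᵥ fun b => y b t) ⟨j, l⟩))
  have hRpos : ∀ j, ∀ t ∈ Ici t₀, 0 < R j t := fun j t ht => hc.trans_le (hb j t (hsub ht)).1
  have hW : ∀ t ∈ Ici t₀, HasDerivWithinAt W (W' t) (Ici t₀) t := by
    intro t ht
    refine HasDerivWithinAt.fun_sum fun j _ => HasDerivWithinAt.const_mul _ ?_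
    have hRd := ((hR j).2 t (hsub ht)).mono (Ici_subset_Ici.2 ht₀)
    have hs := HasDerivWithinAt.fun_sum (u := Finset.univ) fun (i : Fin (D.r j)) _ =>
      (hy t ht ⟨j, i⟩).fun_pow 2
    refine (hRd.mul hs).congr_deriv ?_
    have e : ∑ i, ((2 : ℕ) : ℝ) * y ⟨j, i⟩ t ^ (2 - 1) *
        (D.augMatrix (D.damping g R) t *ᵥ fun b => y b t) ⟨j, i⟩ =
        2 * ∑ l, y ⟨j, l⟩ t * (D.Ahat *ᵥ fun b => y b t) ⟨j, l⟩
          - 2 * D.damping g R j t * ∑ i, y ⟨j, i⟩ t ^ 2 := by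
      simp only [augMatrix_mulVec, Finset.mul_sum, ← Finset.sum_sub_distrib]
      exact Finset.sum_congr rfl fun i _ => by push_cast; ring
    rw [e]
    -- This identity is the purpose of the filter: the excitation term in the derivative of `R j`
    -- cancels the damping exactly, so no sign or size of `g` enters the dissipation.
    have hd : R j t * (2 * D.damping g R j t) = g (D.inp j) t ^ D.expo := by
      have := (hRpos j t ht).ne'
      simp only [damping]
      field_simp
    linear_combination (-∑ i, y ⟨j, i⟩ t ^ 2) * hd
  have hdiss : ∀ t ∈ Ici t₀, W' t ≤ -D.sigma lam * W t := fun t ht =>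
    dissipation_le hσ hc hN1 hN (fun j => R j t) (fun j => hb j t (hsub ht)) fun a => y a t
  have hexp : ∀ t ∈ Ici t₀, HasDerivWithinAt (fun t => Real.exp (D.sigma lam * t) * W t)
      (Real.exp (D.sigma lam * t) * (D.sigma lam * W t + W' t)) (Ici t₀) t := fun t ht => by
    have h1 := (((hasDerivAt_id t).const_mul (D.sigma lam)).exp).hasDerivWithinAt (s := Ici t₀)
    refine (h1.mul (hW t ht)).congr_deriv ?_
    simp only [id]
    ring
  have hanti : AntitoneOn (fun t => Real.exp (D.sigma lam * t) * W t) (Ici t₀) := by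
    refine antitoneOn_of_hasDerivWithinAt_nonpos (convex_Ici t₀)
      (fun s hs => (hexp s hs).continuousWithinAt)
      (fun s hs => (hexp s (interior_subset hs)).mono interior_subset) fun s hs => ?_
    refine mul_nonpos_of_nonneg_of_nonpos (Real.exp_pos _).le ?_
    linarith [hdiss s (interior_subset hs)]
  have hdec := hanti (mem_Ici.2 le_rfl) (mem_Ici.2 ht) ht
  simp only at hdec
  have hWt : W t ≤ Real.exp (-D.sigma lam * (t - t₀)) * W t₀ := by
    have h1 : Real.exp (-D.sigma lam * (t - t₀)) =
        Real.exp (-(D.sigma lam * t)) * Real.exp (D.sigma lam * t₀) := by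
      rw [← Real.exp_add]
      ring_nf
    have h2 : Real.exp (-(D.sigma lam * t)) * Real.exp (D.sigma lam * t) = 1 := by
      rw [← Real.exp_add]
      simp
    have h3 := mul_le_mul_of_nonneg_left hdec (Real.exp_pos (-(D.sigma lam * t))).le
    rw [h1]
    linear_combination h3 + W t * (-h2)
  have hq0 : ∀ t j, 0 ≤ ∑ i : Fin (D.r j), y ⟨j, i⟩ t ^ 2 := fun t j =>
    Finset.sum_nonneg fun _ _ => sq_nonneg _
  have hlow : c * ∑ a, y a t ^ 2 ≤ W t := by
    rw [Fintype.sum_sigma, Finset.mul_sum]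
    refine Finset.sum_le_sum fun j _ => ?_
    have h1 := mul_le_mul_of_nonneg_right (hb j t (hsub ht)).1 (hq0 t j)
    exact h1.trans (le_mul_of_one_le_left (mul_nonneg (hRpos j t ht).le (hq0 t j))
      (one_le_pow₀ hN1))
  have hup : W t₀ ≤ N ^ D.p * C * ∑ a, y a t₀ ^ 2 := by
    rw [Fintype.sum_sigma, Finset.mul_sum]
    refine Finset.sum_le_sum fun j _ => ?_
    have ht' : t₀ ∈ Ici t₀ := mem_Ici.2 le_rfl
    rw [mul_assoc]
    refine mul_le_mul (pow_le_pow_right₀ hN1 j.2.le) ?_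
      (mul_nonneg (hRpos j t₀ ht').le (hq0 t₀ j)) (hNp _).le
    exact mul_le_mul_of_nonneg_right (hb j t₀ (hsub ht')).2 (hq0 t₀ j)
  have hfin := hlow.trans (hWt.trans (mul_le_mul_of_nonneg_left hup (Real.exp_pos _).le))
  rw [mul_comm c, ← le_div_iff₀ hc] at hfin
  refine hfin.trans (le_of_eq ?_)
  ring

end BlockData

/-! ### Existence of the block canonical form. -/

open Polynomial in
theorem coeff_iterate_divX (f : ℝ[X]) (k l : ℕ) : (divX^[k] f).coeff l = f.coeff (l + k) := by
  induction k generalizing l with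
  | zero => rfl
  | succ k ih => rw [Function.iterate_succ_apply', coeff_divX, ih, add_right_comm, add_assoc]

open Polynomial in
theorem iterate_divX_eq (f : ℝ[X]) (k : ℕ) :
    divX^[k] f = X * divX^[k + 1] f + C (f.coeff k) := by
  rw [Function.iterate_succ_apply']
  conv_lhs => rw [← X_mul_divX_add (divX^[k] f)]
  rw [coeff_iterate_divX, zero_add]

open Polynomial in
theorem iterate_divX_natDegree {f : ℝ[X]} (hf : f.Monic) : divX^[f.natDegree] f = 1 := by
  ext l
  rw [coeff_iterate_divX, coeff_one]
  split_ifs with h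
  · rw [h, zero_add]
    exact hf
  · exact coeff_eq_zero_of_natDegree_lt (by omega)

section Krylov

open Polynomial

variable {n m : ℕ} (A : Matrix (Fin n) (Fin n) ℝ) (B : Matrix (Fin n) (Fin m) ℝ)

/-- The span of the vectors `A ^ k b` for the columns `b` of `B` of index less than `q`. -/
def krylov (q : ℕ) : Submodule ℝ (Fin n → ℝ) :=
  Submodule.span ℝ {v | ∃ (s : Fin m) (k : ℕ), (s : ℕ) < q ∧ v = A ^ k *ᵥ B.col s}

variable {A B}

theorem mulVec_mem_krylov {q : ℕ} {v : Fin n → ℝ} (hv : v ∈ krylov A B q) :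
    A *ᵥ v ∈ krylov A B q := by
  have : krylov A B q ≤ (krylov A B q).comap A.mulVecLin := by
    refine Submodule.span_le.2 ?_
    rintro _ ⟨s, k, hs, rfl⟩
    refine Submodule.subset_span ⟨s, k + 1, hs, ?_⟩
    rw [Matrix.mulVecLin_apply, Matrix.mulVec_mulVec, pow_succ']
  exact this hv

theorem aeval_mulVec_mem_krylov {q : ℕ} {v : Fin n → ℝ} (hv : v ∈ krylov A B q) (f : ℝ[X]) :
    aeval A f *ᵥ v ∈ krylov A B q := by
  induction f using Polynomial.induction_on' with
  | add f₁ f₂ h₁ h₂ => rw [map_add, Matrix.add_mulVec]; exact Submodule.add_mem _ h₁ h₂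
  | monomial k c =>
    rw [aeval_monomial, ← Algebra.smul_def, Matrix.smul_mulVec]
    refine Submodule.smul_mem _ _ ?_
    induction k with
    | zero => simpa using hv
    | succ k ih =>
      rw [pow_succ', ← Matrix.mulVec_mulVec]
      exact mulVec_mem_krylov ih

theorem aeval_col_mem_krylov {q : ℕ} {s : Fin m} (hs : (s : ℕ) < q) (f : ℝ[X]) :
    aeval A f *ᵥ B.col s ∈ krylov A B q :=
  aeval_mulVec_mem_krylov (Submodule.subset_span ⟨s, 0, hs, by simp⟩) f

variable (A B) in
/-- The relative minimal polynomial of a column of `B` modulo the previous columns. -/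
theorem exists_relative_minpoly (s : Fin m) : ∃ χ : ℝ[X], χ.Monic ∧
    aeval A χ *ᵥ B.col s ∈ krylov A B s ∧
    ∀ f : ℝ[X], f ≠ 0 → f.natDegree < χ.natDegree → aeval A f *ᵥ B.col s ∉ krylov A B s := by
  classical
  -- By Cayley–Hamilton the characteristic polynomial is a candidate, so one of minimal degree
  -- exists.
  have hex : ∃ r : ℕ, ∃ χ : ℝ[X], χ.Monic ∧ χ.natDegree = r ∧
      aeval A χ *ᵥ B.col s ∈ krylov A B s :=
    ⟨_, A.charpoly, A.charpoly_monic, rfl, by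
      rw [Matrix.aeval_self_charpoly, Matrix.zero_mulVec]; exact Submodule.zero_mem _⟩
  obtain ⟨χ, hm, hd, hχ⟩ := Nat.find_spec hex
  refine ⟨χ, hm, hχ, fun f hf hlt hmem => ?_⟩
  rw [hd] at hlt
  refine Nat.find_min hex hlt ⟨C f.leadingCoeff⁻¹ * f, ?_, ?_, ?_⟩
  · rw [mul_comm]
    exact monic_mul_leadingCoeff_inv hf
  · exact natDegree_C_mul (inv_ne_zero (leadingCoeff_ne_zero.2 hf))
  · rw [map_mul, aeval_C, ← Algebra.smul_def, Matrix.smul_mulVec]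
    exact Submodule.smul_mem _ _ hmem

/-- The vectors `(divX^[i + 1] χ)(A) b` span all `f(A) b` with `f` of degree less than `χ`. -/
theorem aeval_mulVec_mem_span {χ : ℝ[X]} (hχ : χ.Monic) (b : Fin n → ℝ) (f : ℝ[X])
    (hf : f.degree < χ.natDegree) :
    aeval A f *ᵥ b ∈ Submodule.span ℝ
      (range fun i : Fin χ.natDegree => aeval A (divX^[(i : ℕ) + 1] χ) *ᵥ b) := by
  suffices H : ∀ d ≤ χ.natDegree, ∀ f : ℝ[X], f.degree < d → aeval A f *ᵥ b ∈ Submodule.span ℝ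
      (range fun i : Fin χ.natDegree => aeval A (divX^[(i : ℕ) + 1] χ) *ᵥ b) from
    H _ le_rfl f hf
  intro d
  induction d with
  | zero =>
    intro _ f hf
    have : f = 0 := by
      rw [← degree_eq_bot]
      exact Nat.WithBot.lt_zero_iff.1 (by simpa using hf)
    rw [this, map_zero, Matrix.zero_mulVec]
    exact Submodule.zero_mem _
  | succ d ih =>
    intro hd f hf
    -- For this index the quotient `divX^[i + 1] χ` is monic of degree `d`, so it can remove the
    -- leading term of `f`.
    set i : Fin χ.natDegree := ⟨χ.natDegree - 1 - d, by omega⟩ with hi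
    set c := f.coeff d with hc
    have hlt : (f - C c * divX^[(i : ℕ) + 1] χ).degree < d := by
      rw [degree_lt_iff_coeff_zero]
      intro l hl
      rw [coeff_sub, coeff_C_mul, coeff_iterate_divX]
      rcases hl.eq_or_lt with rfl | hl
      · rw [show d + ((i : ℕ) + 1) = χ.natDegree by simp only [hi]; omega, hχ.coeff_natDegree,
          mul_one, sub_self]
      · rw [(degree_lt_iff_coeff_zero _ _).1 hf l (by omega),
          coeff_eq_zero_of_natDegree_lt (by simp only [hi]; omega), mul_zero, sub_zero]
    have h1 := ih (by omega) _ hlt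
    have h2 : aeval A f *ᵥ b = aeval A (f - C c * divX^[(i : ℕ) + 1] χ) *ᵥ b +
        c • (aeval A (divX^[(i : ℕ) + 1] χ) *ᵥ b) := by
      rw [map_sub, map_mul, aeval_C, ← Algebra.smul_def, Matrix.sub_mulVec, Matrix.smul_mulVec,
        sub_add_cancel]
    rw [h2]
    exact Submodule.add_mem _ h1 (Submodule.smul_mem _ _ (Submodule.subset_span ⟨i, rfl⟩))

variable {p : ℕ} {inp : Fin p ↪o Fin m} {χ : Fin m → ℝ[X]}

/-- The vectors of the basis that brings a controllable pair to the block canonical form. -/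
noncomputable def canonicalVec (A : Matrix (Fin n) (Fin n) ℝ) (B : Matrix (Fin n) (Fin m) ℝ)
    (inp : Fin p ↪o Fin m) (χ : Fin m → ℝ[X])
    (a : Σ j : Fin p, Fin (χ (inp j)).natDegree) : Fin n → ℝ :=
  aeval A (divX^[(a.2 : ℕ) + 1] (χ (inp a.1))) *ᵥ B.col (inp a.1)

/-- Division of `X ^ k` by `χ s` splits `A ^ k b` into a remainder, spanned by the vectors of the
block, and a multiple of `χ(A) b`, which belongs to earlier columns. A column with `χ s` of degree 0
has zero remainder and needs no block. -/
theorem krylov_le_span (hm : ∀ s, (χ s).Monic)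
    (hχ : ∀ s : Fin m, aeval A (χ s) *ᵥ B.col s ∈ krylov A B s)
    (hinp : ∀ s, 0 < (χ s).natDegree → s ∈ range inp) (q : ℕ) :
    krylov A B q ≤ Submodule.span ℝ
      (canonicalVec A B inp χ '' {a | (inp a.1 : ℕ) < q}) := by
  induction q using Nat.strong_induction_on with
  | _ q ih =>
    refine Submodule.span_le.2 ?_
    rintro _ ⟨s, k, hs, rfl⟩
    have hprev : krylov A B s ≤ Submodule.span ℝ
        (canonicalVec A B inp χ '' {a | (inp a.1 : ℕ) < q}) :=
      (ih s hs).trans (Submodule.span_mono (image_mono fun a ha => lt_trans ha hs))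
    have hdiv : A ^ k *ᵥ B.col s = aeval A (X ^ k %ₘ χ s) *ᵥ B.col s +
        aeval A (X ^ k /ₘ χ s) *ᵥ (aeval A (χ s) *ᵥ B.col s) := by
      rw [Matrix.mulVec_mulVec, ← map_mul, ← Matrix.add_mulVec, ← map_add, mul_comm,
        modByMonic_add_div, aeval_X_pow]
    rw [SetLike.mem_coe, hdiv]
    refine Submodule.add_mem _ ?_ (hprev (aeval_mulVec_mem_krylov (hχ s) _))
    have hdeg : (X ^ k %ₘ χ s).degree < (χ s).natDegree := by
      rw [← degree_eq_natDegree (hm s).ne_zero]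
      exact degree_modByMonic_lt _ (hm s)
    refine Submodule.span_mono ?_ (aeval_mulVec_mem_span (hm s) (B.col s) _ hdeg)
    rintro _ ⟨i, rfl⟩
    obtain ⟨j, rfl⟩ := hinp s (by have := i.2; omega)
    exact ⟨⟨j, i⟩, hs, rfl⟩

/-- Blocks are treated from the last to the first: the part of a relation in the last remaining
block is `f(A) b` with `f` of degree below `χ`, and it lies in the Krylov space of earlier columns,
so `f = 0` by minimality. -/
theorem linearIndependent_canonicalVec (hm : ∀ s, (χ s).Monic)
    (hmin : ∀ s : Fin m, ∀ f : ℝ[X], f ≠ 0 → f.natDegree < (χ s).natDegree →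
      aeval A f *ᵥ B.col s ∉ krylov A B s) :
    LinearIndependent ℝ (canonicalVec A B inp χ) := by
  rw [Fintype.linearIndependent_iff]
  intro c hc
  have hstep : ∀ j, (∀ s > j, ∀ i, c ⟨s, i⟩ = 0) → ∀ i, c ⟨j, i⟩ = 0 := by
    intro j hj
    set f : ℝ[X] := ∑ i : Fin (χ (inp j)).natDegree,
      C (c ⟨j, i⟩) * divX^[(i : ℕ) + 1] (χ (inp j)) with hf
    have hfe : aeval A f *ᵥ B.col (inp j) = ∑ i, c ⟨j, i⟩ • canonicalVec A B inp χ ⟨j, i⟩ := by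
      rw [hf, map_sum, Matrix.sum_mulVec]
      refine Finset.sum_congr rfl fun i _ => ?_
      rw [map_mul, aeval_C, ← Algebra.smul_def, Matrix.smul_mulVec]
      rfl
    have hmem : aeval A f *ᵥ B.col (inp j) ∈ krylov A B (inp j) := by
      rw [Fintype.sum_sigma, ← Finset.sum_erase_add _ _ (Finset.mem_univ j), ← hfe] at hc
      rw [eq_neg_of_add_eq_zero_right hc]
      refine Submodule.neg_mem _ (Submodule.sum_mem _ fun s hs =>
        Submodule.sum_mem _ fun i _ => ?_)
      rcases lt_or_gt_of_ne (Finset.ne_of_mem_erase hs) with h | h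
      · exact Submodule.smul_mem _ _ (aeval_col_mem_krylov (inp.strictMono h) _)
      · rw [hj s h i, zero_smul]
        exact Submodule.zero_mem _
    have hcoeff : ∀ l, f.coeff l = ∑ i : Fin (χ (inp j)).natDegree,
        c ⟨j, i⟩ * (χ (inp j)).coeff (l + (i + 1)) := fun l => by
      simp only [hf, finsetSum_coeff, coeff_C_mul, coeff_iterate_divX]
    have hf0 : f = 0 := by
      by_contra hne
      refine hmin _ f hne ?_ hmem
      by_contra! hle
      refine hne (leadingCoeff_eq_zero.1 ?_)
      rw [leadingCoeff, hcoeff]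
      exact Finset.sum_eq_zero fun i _ => by
        rw [coeff_eq_zero_of_natDegree_lt (by omega), mul_zero]
    suffices H : ∀ k (hk : k < (χ (inp j)).natDegree), c ⟨j, ⟨k, hk⟩⟩ = 0 from
      fun i => H i i.2
    intro k
    induction k using Nat.strong_induction_on with
    | _ k ih =>
      intro hk
      -- In this degree only index `k` contributes: smaller indices have vanishing coefficients by
      -- induction, larger ones have quotients of lower degree.
      have h := hcoeff ((χ (inp j)).natDegree - 1 - k)
      rw [hf0, coeff_zero, Finset.sum_eq_single ⟨k, hk⟩] at h
      · rw [show (χ (inp j)).natDegree - 1 - k + (k + 1) = (χ (inp j)).natDegree by omega,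
          (hm _).coeff_natDegree, mul_one] at h
        exact h.symm
      · intro i _ hi
        rcases lt_or_gt_of_ne (fun h => hi (Fin.ext h) : (i : ℕ) ≠ k) with hlt | hgt
        · rw [ih i hlt i.2, zero_mul]
        · rw [coeff_eq_zero_of_natDegree_lt (by omega), mul_zero]
      · simp
  have hall : ∀ k : ℕ, ∀ j : Fin p, p ≤ j + k → ∀ i, c ⟨j, i⟩ = 0 := by
    intro k
    induction k with
    | zero => exact fun j hj => absurd j.2 (by omega)
    | succ k ih =>
      exact fun j hj => hstep j fun s hs => ih s (by have := Fin.lt_def.1 hs; omega)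
  rintro ⟨j, i⟩
  exact hall p j (by omega) i

/-- This is Horner's identity `divX^[i] χ = X * divX^[i + 1] χ + C (χ.coeff i)`. For `i > 0` the
first term is the preceding basis vector; for `i = 0` it is `χ(A) b`, the only source of coupling.
-/
theorem mulVec_canonicalVec (j : Fin p) (i : Fin (χ (inp j)).natDegree) :
    A *ᵥ canonicalVec A B inp χ ⟨j, i⟩ = aeval A (divX^[(i : ℕ)] (χ (inp j))) *ᵥ B.col (inp j)
      - (χ (inp j)).coeff i • B.col (inp j) := by
  rw [iterate_divX_eq, map_add, map_mul, aeval_X, aeval_C, Matrix.add_mulVec,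
    Algebra.algebraMap_eq_smul_one, Matrix.smul_mulVec, Matrix.one_mulVec, add_sub_cancel_right,
    ← Matrix.mulVec_mulVec]
  rfl

theorem canonicalVec_lst (hm : ∀ s, (χ s).Monic) (j : Fin p) (l : Fin (χ (inp j)).natDegree)
    (hl : (l : ℕ) + 1 = (χ (inp j)).natDegree) :
    canonicalVec A B inp χ ⟨j, l⟩ = B.col (inp j) := by
  simp only [canonicalVec]
  rw [hl, iterate_divX_natDegree (hm _), map_one, Matrix.one_mulVec]

theorem Controllable.krylov_eq_top (h : Controllable A B) : krylov A B m = ⊤ := by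
  have h1 := h
  rw [Controllable, Matrix.rank_eq_finrank_span_cols] at h1
  have h2 := Submodule.eq_top_of_finrank_eq (by rw [h1]; simp)
  rw [eq_top_iff, ← h2]
  refine Submodule.span_le.2 ?_
  rintro _ ⟨⟨k, s⟩, rfl⟩
  exact Submodule.subset_span ⟨s, k, s.2, rfl⟩

theorem exists_canonicalForm (hn : 0 < n) (hAB : Controllable A B) :
    ∃ (D : BlockData m) (T : Matrix D.Idx (Fin n) ℝ), D.IsCanonicalForm A B T := by
  classical
  choose χ hm hχ hmin using exists_relative_minpoly A B
  set Q : Finset (Fin m) := Finset.univ.filter fun s => 0 < (χ s).natDegree with hQ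
  let inp : Fin Q.card ↪o Fin m := Q.orderEmbOfFin rfl
  have hrange : ∀ s, 0 < (χ s).natDegree ↔ s ∈ range inp := fun s => by
    rw [Finset.range_orderEmbOfFin]
    simp [hQ]
  have hrpos : ∀ j, 0 < (χ (inp j)).natDegree := fun j => (hrange _).2 ⟨j, rfl⟩
  set e := canonicalVec A B inp χ with he
  have hspan : ⊤ ≤ Submodule.span ℝ (range e) := by
    rw [← hAB.krylov_eq_top]
    exact (krylov_le_span hm hχ (fun s => (hrange s).1) m).trans
      (Submodule.span_mono (image_subset_range _ _))
  let b := Module.Basis.mk (linearIndependent_canonicalVec (inp := inp) hm hmin) hspan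
  have hb : ∀ a, b a = e a := fun a => Module.Basis.mk_apply _ _ a
  have hp : 0 < Q.card := by
    by_contra h0
    have : IsEmpty (Fin Q.card) := ⟨fun i => by have := i.2; omega⟩
    have h1 := Module.finrank_eq_card_basis b
    simp only [Module.finrank_fin_fun, Fintype.card_eq_zero] at h1
    omega
  let D : BlockData m :=
    { p := Q.card
      p_pos := hp
      r := fun j => (χ (inp j)).natDegree
      r_pos := hrpos
      inp := inp.toEmbedding
      α := fun j l => (χ (inp j)).coeff l.rev
      β := fun k j l => b.repr (aeval A (χ (inp j)) *ᵥ B.col (inp j)) ⟨k, l⟩ }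
  -- `χ(A) b` lies in the span of strictly earlier blocks, which makes the matrix block upper
  -- triangular.
  have hcouple : ∀ j k : Fin Q.card, j ≤ k → ∀ l,
      b.repr (aeval A (χ (inp j)) *ᵥ B.col (inp j)) ⟨k, l⟩ = 0 := by
    intro j k hjk l
    have h1 := krylov_le_span hm hχ (fun s => (hrange s).1) _ (hχ (inp j))
    have h2 : canonicalVec A B inp χ = b := funext fun a => (hb a).symm
    rw [h2] at h1
    by_contra hne
    have h3 := b.repr_support_subset_of_mem_span _ h1 (Finsupp.mem_support_iff.2 hne)
    exact absurd (inp.lt_iff_lt.1 (Fin.lt_def.2 h3)) (not_lt.2 hjk)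
  have hcol : ∀ a : D.Idx, A *ᵥ e a = ∑ c : D.Idx, D.Ahat c a • e c := by
    rintro ⟨j, i⟩
    have hblock : ∀ k : Fin Q.card, ∑ l, D.block k j l i • e ⟨k, l⟩ =
        (if (i : ℕ) = 0 then
          ∑ l, b.repr (aeval A (χ (inp j)) *ᵥ B.col (inp j)) ⟨k, l⟩ • e ⟨k, l⟩ else 0) +
        if k = j then (if (i : ℕ) = 0 then 0 else
          aeval A (divX^[(i : ℕ)] (χ (inp j))) *ᵥ B.col (inp j))
          - (χ (inp j)).coeff i • B.col (inp j) else 0 := by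
      intro k
      rcases lt_trichotomy k j with h | rfl | h
      · rw [if_neg h.ne, add_zero]
        split_ifs with hi
        · exact Finset.sum_congr rfl fun l _ => by simp [BlockData.block, h.ne, h, hi, D]
        · exact Finset.sum_eq_zero fun l _ => by simp [BlockData.block, h.ne, hi]
      · have h0 : (if (i : ℕ) = 0 then
          ∑ l, b.repr (aeval A (χ (inp k)) *ᵥ B.col (inp k)) ⟨k, l⟩ • e ⟨k, l⟩ else 0) = 0 := by
          split_ifs
          · exact Finset.sum_eq_zero fun l _ => by rw [hcouple k k le_rfl, zero_smul]
          · rfl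
        rw [h0, zero_add, if_pos rfl]
        have hsplit : ∀ l : Fin (χ (inp k)).natDegree, D.block k k l i • e ⟨k, l⟩ =
            (if (i : ℕ) = (l : ℕ) + 1 then e ⟨k, l⟩ else 0) -
              (if (l : ℕ) + 1 = (χ (inp k)).natDegree then
                (χ (inp k)).coeff i • B.col (inp k) else 0) := by
          intro l
          have hi2 : (i : ℕ) < (χ (inp k)).natDegree := i.2
          simp only [BlockData.block, Matrix.of_apply, if_true]
          by_cases hl : (l : ℕ) + 1 = (χ (inp k)).natDegree
          · rw [if_pos hl, if_neg (by omega), if_pos hl, zero_sub, he,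
              canonicalVec_lst hm k l hl, neg_smul]
            simp only [D, Fin.rev_rev]
          · rw [if_neg hl, if_neg hl, sub_zero]
            split_ifs <;> simp
        rw [Finset.sum_congr rfl fun l _ => hsplit l, Finset.sum_sub_distrib]
        congr 1
        · split_ifs with hi
          · exact Finset.sum_eq_zero fun l _ => by rw [if_neg (by omega)]
          · have hi2 : (i : ℕ) < (χ (inp k)).natDegree := i.2
            rw [Finset.sum_eq_single (⟨i - 1, by omega⟩ : Fin (χ (inp k)).natDegree)]
            · rw [if_pos (by simp only; omega)]
              simp only [he, canonicalVec]
              rw [Nat.sub_add_cancel (by omega)]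
            · intro l _ hl
              exact if_neg fun h => hl (Fin.ext (by simp only; omega))
            · simp
        · rw [Finset.sum_eq_single (⟨(χ (inp k)).natDegree - 1, by have := hrpos k; omega⟩ :
            Fin (χ (inp k)).natDegree)]
          · rw [if_pos (by have := hrpos k; simp only; omega)]
          · intro l _ hl
            exact if_neg fun h => hl (Fin.ext (by simp only; omega))
          · simp
      · rw [if_neg h.ne', add_zero]
        rw [Finset.sum_eq_zero fun l _ => by simp [BlockData.block, h.ne', h.asymm]]
        split_ifs
        · exact (Finset.sum_eq_zero fun l _ => by rw [hcouple j k h.le, zero_smul]).symm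
        · rfl
    rw [Fintype.sum_sigma]
    have hsum := Finset.sum_congr (s₁ := Finset.univ) rfl fun k _ => hblock k
    refine (mulVec_canonicalVec (inp := inp) (χ := χ) j i).trans (Eq.trans ?_ hsum.symm)
    rw [Finset.sum_add_distrib, Finset.sum_ite_eq' Finset.univ j, if_pos (Finset.mem_univ j),
      ← add_sub_assoc]
    congr 1
    by_cases hi : (i : ℕ) = 0
    · simp only [hi, if_true, add_zero]
      have hr := b.sum_repr (aeval A (χ (inp j)) *ᵥ B.col (inp j))
      rw [Fintype.sum_sigma] at hr
      simp only [hb] at hr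
      exact hr.symm
    · simp [hi]
  have hS : ∀ q (a : D.Idx), (Pi.basisFun ℝ (Fin n)).toMatrix b q a = e a q := fun q a => by
    rw [Module.Basis.toMatrix_apply, Pi.basisFun_repr, hb]
  have hTS := b.toMatrix_mul_toMatrix_flip (Pi.basisFun ℝ (Fin n))
  refine ⟨D, b.toMatrix (Pi.basisFun ℝ (Fin n)), ⟨(Pi.basisFun ℝ (Fin n)).toMatrix b, hTS,
    (Pi.basisFun ℝ (Fin n)).toMatrix_mul_toMatrix_flip b, ?_⟩, fun j => ?_⟩
  · have hAS : A * (Pi.basisFun ℝ (Fin n)).toMatrix b =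
        (Pi.basisFun ℝ (Fin n)).toMatrix b * D.Ahat := by
      ext q a
      have h := congrFun (hcol a) q
      rw [Finset.sum_apply] at h
      simp only [Matrix.mul_apply, hS]
      refine Eq.trans h (Finset.sum_congr rfl fun c _ => ?_)
      rw [Pi.smul_apply, smul_eq_mul, mul_comm]
    rw [Matrix.mul_assoc, hAS, ← Matrix.mul_assoc, hTS, Matrix.one_mul]
  · ext a
    have h := congrFun (congrFun hTS a) ⟨j, D.lst j⟩
    simp only [Matrix.mul_apply, hS] at h
    rw [he, canonicalVec_lst hm j (D.lst j) (Nat.sub_add_cancel (hrpos j))] at h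
    rw [Matrix.mul_apply]
    refine Eq.trans h ?_
    rw [Matrix.one_apply, Pi.single_apply]

end Krylov
-- From the augmented states back to `x`.
namespace BlockData

variable {n m : ℕ} {D : BlockData m} {A : Matrix (Fin n) (Fin n) ℝ} {B : Matrix (Fin n) (Fin m) ℝ}
  {T : Matrix D.Idx (Fin n) ℝ} {g : Fin m → ℝ → ℝ} {R : Fin D.p → ℝ → ℝ} {lam : Fin D.p → ℝ}
  {d : ℕ}

theorem divPow_damping {j : Fin D.p} {c : ℝ} (hc : 0 < c) (hb : ∀ t ∈ Ici (0 : ℝ), c ≤ R j t)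
    (hR : BD d (R j)) : DivPow (g (D.inp j)) D.expo d (D.damping g R j) := by
  refine ⟨fun t => (2 * R j t)⁻¹, (hR.const_mul 2).inv (c := c) hc fun t ht => ?_, fun t _ => ?_⟩
  · linarith [hb t ht]
  · simp only [damping, div_eq_mul_inv]

theorem IsPersistenceFilter.uniform_bounds (hR : D.IsPersistenceFilter g lam R)
    (hl : ∀ j, 0 < lam j) (hg : ∀ q, BD d (g q)) (hPE : ∀ q, PersistentlyExciting (g q)) :
    ∃ c C : ℝ, 0 < c ∧ (∀ j, ∀ t ∈ Ici (0 : ℝ), c ≤ R j t ∧ R j t ≤ C) ∧ ∀ j, BD d (R j) := by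
  choose c C hc hb hd using fun j => hR.bounds hl hg hPE j
  have hne : (Finset.univ : Finset (Fin D.p)).Nonempty := ⟨D.fstBlock, Finset.mem_univ _⟩
  refine ⟨Finset.univ.inf' hne c, Finset.univ.sup' hne C, ?_, fun j t ht => ⟨?_, ?_⟩, hd⟩
  · exact (Finset.lt_inf'_iff hne).2 fun j _ => hc j
  · exact (Finset.inf'_le _ (Finset.mem_univ j)).trans (hb j t ht).1
  · exact (hb j t ht).2.trans (Finset.le_sup' _ (Finset.mem_univ j))

/-- Exponential decay of all closed-loop trajectories. -/
theorem closedLoop_decay (hT : D.IsCanonicalForm A B T) (hg : ∀ q, BD d (g q))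
    (hrd : ∀ j, D.r j ≤ d + 1) (hR : D.IsPersistenceFilter g lam R) (hσ : 0 < D.sigma lam)
    {c C : ℝ} (hc : 0 < c) (hb : ∀ j, ∀ t ∈ Ici (0 : ℝ), c ≤ R j t ∧ R j t ≤ C)
    (hh : ∀ j, DivPow (g (D.inp j)) D.expo d (D.damping g R j)) :
    ∃ M : ℝ, 0 < M ∧ ∀ t₀ : ℝ, 0 ≤ t₀ → ∀ (x : ℝ → Fin n → ℝ) (u : ℝ → Fin m → ℝ)
      (Ω : (j : Fin D.p) → Fin (D.r j) → ℝ → ℝ), D.ClosedLoop A B T g R t₀ x u Ω →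
      ∀ t : ℝ, t₀ ≤ t → ‖WithLp.toLp 2 (x t)‖ ≤
        M * Real.exp (-(D.sigma lam / 2) * (t - t₀)) * ‖WithLp.toLp 2 (x t₀)‖ := by
  obtain ⟨M, hM, hdecay⟩ := augmented_decay hR hσ hc hb
  obtain ⟨K, hK, hPb⟩ := exists_bound_augDiff hg hh hrd D.r_le_expo
  obtain ⟨C', hC', hinv⟩ := exists_bound_unipotent D.height hK
  obtain ⟨⟨S, -, hST, -⟩, -⟩ := id hT
  let eL := WithLp.linearEquiv 2 ℝ (Fin n → ℝ)
  let fT : EuclideanSpace ℝ (Fin n) →L[ℝ] (D.Idx → ℝ) :=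
    (T.mulVecLin ∘ₗ eL.toLinearMap).toContinuousLinearMap
  let fS : (D.Idx → ℝ) →L[ℝ] EuclideanSpace ℝ (Fin n) :=
    (eL.symm.toLinearMap ∘ₗ S.mulVecLin).toContinuousLinearMap
  set ν : ℝ := (Fintype.card D.Idx : ℝ) with hν
  have hν0 : 0 ≤ ν := Nat.cast_nonneg _
  -- The factors follow the chain from `x(t₀)` to `Ω(t₀)`, `Ω(t)`, `z(t)` and `x(t)`; `√ν` comes
  -- from comparing sup norm and sum of squares. The added 1 makes the constant positive even if an
  -- operator norm is zero.
  refine ⟨‖fS‖ * (1 + ν * K) * (√(M * ν) * (C' * ‖fT‖)) + 1, by positivity,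
    fun t₀ ht₀ x u Ω hcl t ht => ?_⟩
  set y : ℝ → D.Idx → ℝ := fun t b => Ω b.1 b.2 t with hy
  have hsub : ∀ {t}, t ∈ Ici t₀ → t ∈ Ici (0 : ℝ) := fun h => mem_Ici.2 (ht₀.trans h)
  have hrel : ∀ t ∈ Ici t₀, ∀ a, y t a - (D.augDiff (D.damping g R) t *ᵥ y t) a =
      (T *ᵥ x t) a := by
    rintro t ht ⟨j, i⟩
    have := hcl.sub_eq hT ht₀ hg hh hrd D.r_le_expo j i i.2 ht
    simp only [hy]
    change Ω j i t - ∑ b, D.augCoeff (D.damping g R) j i b t * Ω b.1 b.2 t = _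
    rw [← this]
    exact sub_sub_cancel _ _
  have ht₀' : t₀ ∈ Ici t₀ := mem_Ici.2 le_rfl
  have hini : ‖y t₀‖ ≤ C' * ‖fT‖ * ‖WithLp.toLp 2 (x t₀)‖ := by
    refine (pi_norm_le_iff_of_nonneg (by positivity)).2 fun a => ?_
    refine (hinv _ (hPb t₀ ht₀) (height_lt_of_augDiff_ne_zero _ ht₀) _ _ (hrel t₀ ht₀') a).trans ?_
    rw [mul_assoc]
    exact mul_le_mul_of_nonneg_left (fT.le_opNorm (WithLp.toLp 2 (x t₀))) hC'.le
  have hflow : ‖y t‖ ≤ √(M * ν) * Real.exp (-(D.sigma lam / 2) * (t - t₀)) * ‖y t₀‖ := by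
    have h1 := hdecay t₀ ht₀ (fun b t => y t b) (fun s hs a => hcl.hasDerivWithinAt_aug hT a hs) t ht
    have h2 : ∑ a, y t₀ a ^ 2 ≤ ν * ‖y t₀‖ ^ 2 := by
      refine (Finset.sum_le_card_nsmul Finset.univ _ (‖y t₀‖ ^ 2) fun a _ => ?_).trans (by simp [hν])
      rw [← sq_abs]
      exact pow_le_pow_left₀ (abs_nonneg _) (norm_le_pi_norm (y t₀) a) 2
    refine (pi_norm_le_iff_of_nonneg (by positivity)).2 fun a => ?_
    refine abs_le_of_sq_le_sq ?_ (by positivity)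
    have h3 : y t a ^ 2 ≤ ∑ a, y t a ^ 2 :=
      Finset.single_le_sum (f := fun a => y t a ^ 2) (fun _ _ => sq_nonneg _) (Finset.mem_univ a)
    have h4 : Real.exp (-(D.sigma lam / 2) * (t - t₀)) ^ 2 =
        Real.exp (-D.sigma lam * (t - t₀)) := by
      rw [← Real.exp_nat_mul]
      congr 1
      push_cast
      ring
    rw [mul_pow, mul_pow, Real.sq_sqrt (by positivity), h4]
    calc y t a ^ 2 ≤ _ := h3.trans h1
      _ ≤ M * Real.exp (-D.sigma lam * (t - t₀)) * (ν * ‖y t₀‖ ^ 2) :=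
        mul_le_mul_of_nonneg_left h2 (by positivity)
      _ = _ := by ring
  have hz : ‖T *ᵥ x t‖ ≤ (1 + ν * K) * ‖y t‖ := by
    refine (pi_norm_le_iff_of_nonneg (by positivity)).2 fun a => ?_
    rw [← hrel t ht a, add_mul, one_mul]
    refine (norm_sub_le _ _).trans (add_le_add (norm_le_pi_norm (y t) a) ?_)
    refine (norm_sum_le _ _).trans ((Finset.sum_le_card_nsmul Finset.univ _ (K * ‖y t‖)
      fun b _ => ?_).trans (by simp [hν, mul_assoc]))
    rw [norm_mul]
    exact mul_le_mul (hPb t (hsub ht) a b) (norm_le_pi_norm (y t) b) (norm_nonneg _) hK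
  have hx : ‖WithLp.toLp 2 (x t)‖ ≤ ‖fS‖ * ‖T *ᵥ x t‖ := by
    have h1 : fS (T *ᵥ x t) = WithLp.toLp 2 (x t) := by
      change WithLp.toLp 2 (S *ᵥ (T *ᵥ x t)) = _
      rw [Matrix.mulVec_mulVec, hST, Matrix.one_mulVec]
    rw [← h1]
    exact fS.le_opNorm _
  set E := Real.exp (-(D.sigma lam / 2) * (t - t₀)) with hE
  have hEpos : 0 < E := Real.exp_pos _
  calc ‖WithLp.toLp 2 (x t)‖ ≤ ‖fS‖ * ((1 + ν * K) * (√(M * ν) * E *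
        (C' * ‖fT‖ * ‖WithLp.toLp 2 (x t₀)‖))) := by
        refine hx.trans (mul_le_mul_of_nonneg_left (hz.trans
          (mul_le_mul_of_nonneg_left (hflow.trans
            (mul_le_mul_of_nonneg_left hini ?_)) ?_)) (norm_nonneg _)) <;> positivity
    _ = ‖fS‖ * (1 + ν * K) * (√(M * ν) * (C' * ‖fT‖)) * (E * ‖WithLp.toLp 2 (x t₀)‖) := by ring
    _ ≤ (‖fS‖ * (1 + ν * K) * (√(M * ν) * (C' * ‖fT‖)) + 1) * (E * ‖WithLp.toLp 2 (x t₀)‖) :=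
        mul_le_mul_of_nonneg_right (by linarith) (by positivity)
    _ = _ := by ring

end BlockData
end PersistentFilter

theorem theorem1 {n m : ℕ} (hn : 0 < n)
    (A : Matrix (Fin n) (Fin n) ℝ) (B : Matrix (Fin n) (Fin m) ℝ)
    (hAB : PersistentFilter.Controllable A B)
    (g : Fin m → ℝ → ℝ)
    (hg : ∀ q, PersistentFilter.BoundedDerivs (n - 1) (g q))
    (hPE : ∀ q, PersistentFilter.PersistentlyExciting (g q)) :
    -- the transformation to the canonical form exists
    (∃ (D : PersistentFilter.BlockData m) (T : Matrix D.Idx (Fin n) ℝ),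
      D.IsCanonicalForm A B T) ∧
    ∀ (D : PersistentFilter.BlockData m) (T : Matrix D.Idx (Fin n) ℝ), D.IsCanonicalForm A B T →
      (∀ lam : Fin D.p → ℝ, (∀ j, 0 < lam j) → D.CouplingIneq lam →
        -- the persistence filters have solutions from all positive initial values
        (∀ R₀ : Fin D.p → ℝ, (∀ j, 0 < R₀ j) →
          ∃ R : Fin D.p → ℝ → ℝ, D.IsPersistenceFilter g lam R ∧ ∀ j, R j 0 = R₀ j) ∧
        -- the closed loop converges exponentially, with an estimate of the rate
        0 < D.sigma lam ∧
        ∀ R : Fin D.p → ℝ → ℝ, D.IsPersistenceFilter g lam R →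
          ∃ M : ℝ, 0 < M ∧ ∀ t₀ : ℝ, 0 ≤ t₀ →
            (∀ x₀ : Fin n → ℝ, ∃ (x : ℝ → Fin n → ℝ) (u : ℝ → Fin m → ℝ)
                (Ω : (j : Fin D.p) → Fin (D.r j) → ℝ → ℝ),
              D.ClosedLoop A B T g R t₀ x u Ω ∧ x t₀ = x₀ ∧ ContinuousOn u (Set.Ici t₀)) ∧
            ∀ (x : ℝ → Fin n → ℝ) (u : ℝ → Fin m → ℝ)
                (Ω : (j : Fin D.p) → Fin (D.r j) → ℝ → ℝ),
              D.ClosedLoop A B T g R t₀ x u Ω → ∀ t : ℝ, t₀ ≤ t →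
                ‖WithLp.toLp 2 (x t)‖ ≤
                  M * Real.exp (-(D.sigma lam / 2) * (t - t₀)) * ‖WithLp.toLp 2 (x t₀)‖) ∧
      -- the rate can be made arbitrarily large by the choice of the filter gains
      ∀ ρ : ℝ, ∃ lam : Fin D.p → ℝ, (∀ j, 0 < lam j) ∧ D.CouplingIneq lam ∧
        ρ ≤ D.sigma lam / 2 := by
  have hgd : ∀ q, PersistentFilter.BD (n - 1) (g q) := fun q => (hg q).bd
  refine ⟨PersistentFilter.exists_canonicalForm hn hAB, fun D T hT => ⟨?_, D.exists_gains⟩⟩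
  intro lam hlam hcoup
  have hσ := PersistentFilter.BlockData.sigma_pos hcoup
  refine ⟨fun R₀ hR₀ => PersistentFilter.BlockData.exists_persistenceFilter hgd R₀ hR₀, hσ,
    fun R hR => ?_⟩
  -- A block has size at most `n`, so `n - 1` derivatives of the excitation cover every stage of the
  -- recursion.
  have hrd : ∀ j, D.r j ≤ n - 1 + 1 := fun j => by
    have := hT.r_le j
    omega
  obtain ⟨c, C, hc, hb, hRd⟩ := hR.uniform_bounds hlam hgd hPE
  have hh := fun j => PersistentFilter.BlockData.divPow_damping (g := g) hc
    (fun t ht => (hb j t ht).1) (hRd j)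
  obtain ⟨M, hM, hdecay⟩ :=
    PersistentFilter.BlockData.closedLoop_decay hT hgd hrd hR hσ hc hb hh
  exact ⟨M, hM, fun t₀ ht₀ => ⟨fun x₀ =>
    PersistentFilter.BlockData.exists_closedLoop hT hgd hh hrd D.r_le_expo ht₀ x₀, hdecay t₀ ht₀⟩⟩
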